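/- **Notation.** For a symmetric $M\in\mathbb R^{d\times d}$ with eigenvalues $\lambda_1(M)\ge\dots\ge\lambda_d(M)$ and $1\le r\le d$ put $\underline\lambda_r(M)=\frac1r\sum_{i=d-r+1}^{d}\lambda_i(M)$ and $\overline\lambda_r(M)=\frac1r\sum_{i=1}^{r}\lambda_i(M)$. Let $\mathrm{St}_k^d=\{Q\in\mathbb R^{d\times k}:Q^\top Q=I_k\}$. For $C\ge1$, a *$C$-packing* of $\mathrm{St}_k^d$ is a finite set $\mathcal P\subset\mathrm{St}_k^d$ with $|\mathcal P|\ge 2^{kd}$ and $\|Q-Q'\|_{\mathrm F}>\sqrt k/C$ for all distinct $Q,Q'\in\mathcal P$. **Models.** *Multivariate regression:* the data are $n$ i.i.d. pairs $(x_i,y_i)$ with $y_i=Ax_i+\eta_i$, where $A\in\mathbb R^{d_y\times d_x}$, the $x_i\in\mathbb R^{d_x}$ have finite second moments and $\Sigma=\mathbb E[x_ix_i^\top]\succ0$, and $\eta_i\sim\mathcal N(0,\sigma^2I_{d_y})$ is independent of $x_i$. *Linear system identification:* $d_x=d_y=d$, $x_0=0$, $x_{t+1}=Ax_t+\eta_t$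 with $\eta_t$ i.i.d. $\mathcal N(0,\sigma^2I_d)$, the data are the $n$ pairs $(x_i,y_i)=(x_i,x_{i+1})$, $1\le i\le n$, of one trajectory, and $A$ has spectral radius $<1$. Put $G(A)=\sum_{t\ge0}A^t(A^t)^\top$, and let $\Gamma_\infty(A)=\sigma^2G(A)$ be the limiting covariance of $x_t$. In both cases $\sigma>0$, and $\mathbb P_{A'}$ denotes the law of the data when the parameter is $A'$. **Stability.** Let $M=\Sigma$ in regression and $M=\Gamma_\infty(A)$ in system identification. Let $W\in\mathrm{St}_r^{d_x}$ have as columns eigenvectors of $M$ for its $r$ smallest eigenvalues, let $U\in\mathrm{St}_r^{d_y}$ have as columns left singular vectors of $A$ for its $r$ largest singular values, and let $\mathcal P_y,\mathcal P_x$ be $C$-packings of $\mathrm{St}_r^{d_y}$ and $\mathrm{St}_r^{d_x}$. Put $$\mathcal C(A,r,\varepsilon)=\{A\}\cup\Big\{A+\tfrac{2C\varepsilon}{\sqrt r}QW^\top:Q\in\mathcal P_y\Big\}\cup\Big\{A+\tfrac{2C\varepsilon}{\sqrt r}UR^\top:R\in\mathcal P_x\Big\}.$$ An algorithm $(\hat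 A_n)_{n\ge0}$ ($\hat A_n$ a measurable function of $n$ observations) is *$(\varepsilon,\delta,r)$-stable at $A$* if for some $n$ one has $\mathbb P_{A'}(\|\hat A_n-A'\|_{\mathrm F}\le\varepsilon)\ge1-\delta$ for all $A'\in\mathcal C(A,r,\varepsilon)$; its *sample complexity* $N$ is the least such $n$. **Theorem.** There are universal constants $C\ge1$ and $c>0$ such that $C$-packings of $\mathrm{St}_k^d$ exist whenever $1\le k\le d/2$, and such that the following holds for every $\varepsilon>0$, every $\delta\in(0,1/2]$, every $r$ and $A$ with $\mathrm{rank}(A)\le r$ and $1\le r\le\min(d_x,d_y)/2$, every admissible choice of $U,W,\mathcal P_x,\mathcal P_y$, and every algorithm that is $(\varepsilon,\delta,r)$-stable at $A$, with sample complexity $N$. 1. In multivariate regression, $$N\ \ge\ c\,\sigma^2\max\left\{\frac{\log(1/\delta)+r\,d_y}{\varepsilon^2\,\underline\lambda_r(\Sigma)},\ \frac{\log(1/\delta)+r\,d_x}{\varepsilon^2\,\overline\lambda_r(\Sigma)}\right\}.$$ 2. In linear system identification, if moreover $\frac{2C\varepsilon}{\sqrt r}\le\frac14\|G(A)\|_2^{-3}$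 (spectral norm), the same bound holds with $\Sigma$ replaced by $\Gamma_\infty(A)$ and $d_x=d_y=d$. -/

import Mathlib

open MeasureTheory ProbabilityTheory
open scoped Matrix

namespace RankLB

/-- The Frobenius norm of a real matrix. -/
noncomputable def frobNorm {m n : ℕ} (M : Matrix (Fin m) (Fin n) ℝ) : ℝ :=
  Real.sqrt (∑ i, ∑ j, M i j ^ 2)

/-- The spectral norm (largest singular value) of a real square matrix. -/
noncomputable def opNorm {d : ℕ} (M : Matrix (Fin d) (Fin d) ℝ) : ℝ :=
  ‖Matrix.toEuclideanCLM (n := Fin d) (𝕜 := ℝ) M‖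

/-- The `i`-th largest eigenvalue, with multiplicity and counted from `i = 0`, of a real symmetric
`d × d` matrix (and `0` if `M` is not symmetric or `i ≥ d`). -/
noncomputable def eig {d : ℕ} (M : Matrix (Fin d) (Fin d) ℝ) (i : ℕ) : ℝ :=
  open scoped Classical in
  if hM : M.IsHermitian then
    if hi : i < Fintype.card (Fin d) then hM.eigenvalues₀ ⟨i, hi⟩ else 0
  else 0

/-- The average of the `r` smallest eigenvalues. -/
noncomputable def lambdaLow {d : ℕ} (r : ℕ) (M : Matrix (Fin d) (Fin d) ℝ) : ℝ :=
  (∑ j : Fin r, eig M (d - r + j)) / r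

/-- The average of the `r` largest eigenvalues. -/
noncomputable def lambdaHigh {d : ℕ} (r : ℕ) (M : Matrix (Fin d) (Fin d) ℝ) : ℝ :=
  (∑ j : Fin r, eig M j) / r

/-- `Q` has orthonormal columns, i.e. lies in the Stiefel manifold. -/
def IsStiefel {d k : ℕ} (Q : Matrix (Fin d) (Fin k) ℝ) : Prop := Qᵀ * Q = 1

/-- The columns of `W` are orthonormal eigenvectors of `M` for its `r` smallest eigenvalues. -/
def IsBottomEigenframe {d r : ℕ} (M : Matrix (Fin d) (Fin d) ℝ) (W : Matrix (Fin d) (Fin r) ℝ) :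
    Prop :=
  IsStiefel W ∧ M * W = W * Matrix.diagonal (fun j : Fin r => eig M (d - r + j))

/-- The columns of `U` are orthonormal left singular vectors of `A` for its `r` largest singular
values, i.e. orthonormal eigenvectors of `A Aᵀ` for its `r` largest eigenvalues. -/
def IsTopLeftSingularFrame {m n r : ℕ} (A : Matrix (Fin m) (Fin n) ℝ)
    (U : Matrix (Fin m) (Fin r) ℝ) : Prop :=
  IsStiefel U ∧ A * Aᵀ * U = U * Matrix.diagonal (fun j : Fin r => eig (A * Aᵀ) j)

/-- A finite set of at least `2 ^ (k d)` points of the Stiefel manifold whose pairwise Frobenius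
distances exceed `√k / C`. -/
def IsStiefelPacking {d k : ℕ} (C : ℝ) (P : Finset (Matrix (Fin d) (Fin k) ℝ)) : Prop :=
  (∀ Q ∈ P, IsStiefel Q) ∧ 2 ^ (k * d) ≤ P.card ∧
    ∀ Q ∈ P, ∀ Q' ∈ P, Q ≠ Q' → Real.sqrt k / C < frobNorm (Q - Q')

/-- The confusing models around `A`: `A` itself, the matrices `A + (2Cε/√r) Q Wᵀ` with `Q` in the
packing `Py`, and the matrices `A + (2Cε/√r) U Rᵀ` with `R` in the packing `Px`. -/
def confusingModels {dx dy r : ℕ} (C ε : ℝ) (A : Matrix (Fin dy) (Fin dx) ℝ)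
    (U : Matrix (Fin dy) (Fin r) ℝ) (W : Matrix (Fin dx) (Fin r) ℝ)
    (Py : Finset (Matrix (Fin dy) (Fin r) ℝ)) (Px : Finset (Matrix (Fin dx) (Fin r) ℝ)) :
    Set (Matrix (Fin dy) (Fin dx) ℝ) :=
  {A} ∪ {A' | ∃ Q ∈ Py, A' = A + (2 * C * ε / Real.sqrt r) • (Q * Wᵀ)}
    ∪ {A' | ∃ R ∈ Px, A' = A + (2 * C * ε / Real.sqrt r) • (U * Rᵀ)}

/-- A data set of `n` observations `(x_i, y_i)`. -/
abbrev Data (dx dy n : ℕ) : Type := Fin n → (Fin dx → ℝ) × (Fin dy → ℝ)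

/-- An estimation algorithm: for every number `n` of observations, a map from data sets to
matrices. -/
abbrev Algorithm (dx dy : ℕ) : Type := (n : ℕ) → Data dx dy n → Matrix (Fin dy) (Fin dx) ℝ

/-- A statistical model: the law of `n` observations under each parameter matrix. -/
abbrev Model (dx dy : ℕ) : Type :=
  Matrix (Fin dy) (Fin dx) ℝ → (n : ℕ) → Measure (Data dx dy n)

/-- Entrywise measurability of the estimators. -/
def Algorithm.IsMeasurable {dx dy : ℕ} (alg : Algorithm dx dy) : Prop :=
  ∀ n i j, Measurable fun ω : Data dx dy n => alg n ω i j

/-- With `n` observations, the algorithm estimates every matrix of the class `𝒞` within Frobenius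
error `ε` with probability at least `1 - δ`. -/
def StableWith {dx dy : ℕ} (P : Model dx dy) (𝒞 : Set (Matrix (Fin dy) (Fin dx) ℝ)) (ε δ : ℝ)
    (alg : Algorithm dx dy) (n : ℕ) : Prop :=
  ∀ A' ∈ 𝒞, 1 - δ ≤ (P A' n).real {ω | frobNorm (alg n ω - A') ≤ ε}

/-- The algorithm is stable over the class `𝒞`: some number of observations suffices. -/
def IsStable {dx dy : ℕ} (P : Model dx dy) (𝒞 : Set (Matrix (Fin dy) (Fin dx) ℝ)) (ε δ : ℝ)
    (alg : Algorithm dx dy) : Prop :=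
  ∃ n, StableWith P 𝒞 ε δ alg n

/-- The sample complexity of a stable algorithm: the least sufficient number of observations. -/
noncomputable def sampleComplexity {dx dy : ℕ} (P : Model dx dy)
    (𝒞 : Set (Matrix (Fin dy) (Fin dx) ℝ)) (ε δ : ℝ) (alg : Algorithm dx dy) : ℕ :=
  sInf {n | StableWith P 𝒞 ε δ alg n}

/-- The centered Gaussian law with covariance `σ² I` on `ℝ^d`. -/
noncomputable def gaussianNoise (σ : ℝ) (d : ℕ) : Measure (Fin d → ℝ) :=
  Measure.pi fun _ => gaussianReal 0 (Real.toNNReal (σ ^ 2))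

/-- Multivariate regression: `n` independent copies of `(x, A x + η)` with `x ∼ μ` and
`η ∼ N(0, σ² I)` independent. -/
noncomputable def regressionModel {dx dy : ℕ} (μ : Measure (Fin dx → ℝ)) (σ : ℝ) : Model dx dy :=
  fun A n => Measure.pi fun _ : Fin n =>
    (μ.prod (gaussianNoise σ dy)).map fun p => (p.1, A *ᵥ p.1 + p.2)

/-- The second-moment matrix `E[x xᵀ]` of `x ∼ μ`. -/
noncomputable def secondMoment {d : ℕ} (μ : Measure (Fin d → ℝ)) : Matrix (Fin d) (Fin d) ℝ :=
  Matrix.of fun i j => ∫ x, x i * x j ∂μ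

/-- The linear dynamical system `x_0 = 0`, `x_{t+1} = A x_t + η_t`. -/
noncomputable def trajectory {d : ℕ} (A : Matrix (Fin d) (Fin d) ℝ) (η : ℕ → Fin d → ℝ) :
    ℕ → Fin d → ℝ
  | 0 => 0
  | t + 1 => A *ᵥ trajectory A η t + η t

/-- Linear system identification: the law of the `n` observations `(x_i, x_{i+1})`, `1 ≤ i ≤ n`,
along one trajectory driven by independent `N(0, σ² I)` noise. -/
noncomputable def systemModel {d : ℕ} (σ : ℝ) : Model d d :=
  fun A n => (Measure.infinitePi fun _ : ℕ => gaussianNoise σ d).map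
    fun η => fun i : Fin n => (trajectory A η (i + 1), trajectory A η (i + 2))

/-- All complex eigenvalues of `A` have modulus less than one. -/
def IsSchurStable {d : ℕ} (A : Matrix (Fin d) (Fin d) ℝ) : Prop :=
  spectralRadius ℂ (A.map (algebraMap ℝ ℂ)) < 1

/-- The (unit-noise) controllability Gramian `∑_{t ≥ 0} A^t (A^t)ᵀ`. -/
noncomputable def gramian {d : ℕ} (A : Matrix (Fin d) (Fin d) ℝ) : Matrix (Fin d) (Fin d) ℝ :=
  ∑' t : ℕ, A ^ t * (A ^ t)ᵀ

/-- The limiting state covariance `σ² ∑_{t ≥ 0} A^t (A^t)ᵀ` of the linear system. -/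
noncomputable def limitCov {d : ℕ} (σ : ℝ) (A : Matrix (Fin d) (Fin d) ℝ) :
    Matrix (Fin d) (Fin d) ℝ :=
  σ ^ 2 • gramian A

end RankLB

namespace RankLB

open scoped ENNReal

/-! The bounds come from testing many hypotheses at once. Each family of alternatives is `A` plus a
scaled isometric image of a packing, so ε-accurate estimation of different parameters yields
disjoint events. Under the law at `A` these events, at least 2^(rd) in number, have total mass at
most 1, so one alternative B has an event of mass at most 2^(-rd). That event is also disjoint from
success at `A`, hence has mass at most δ, while under the law of B it has mass at least 1/2. If K
bounds the relative entropy of the two laws, K must therefore be at least of order log(1/δ) + rd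
(`entropy_lower_bound`). Since K is proportional to n, this bounds n from below.

To compute K, both models are written as images of Gaussian noise. Passing from `A` to `A + D` adds
the predictable shift D x_t to the noise, and Girsanov's formula (`lintegral_comp_map`) follows by
translating one Gaussian coordinate block at a time. `changeOfMeasureBound_map` turns the expected
squared shift directly into a comparison of event probabilities. For D = s Q Vᵀ the squared shift is
s²|Vᵀx|², with expectation s² tr(Vᵀ M V) when M is the second moment of x. The bottom eigenframe V =
W makes the trace r times the low average; for an arbitrary frame V = R, Ky Fan's inequality
(`trace_compression_le`) bounds it by r times the high average.

In system identification the relevant covariance is that of the perturbed system. Under the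
smallness assumption 4G(A) satisfies the Lyapunov inequality for `A + D`
(`gramian_lyapunov_perturbed`), and any such supersolution dominates the state covariance at every
finite time (`exists_linear_representation`).

The packings (`exists_stiefelPacking`) are codes over a 256-letter alphabet, restricted to matrices
with nearly orthogonal columns and carried to the Stiefel manifold by inverse stereographic
projection, which is almost a dilation by 2 on small matrices. -/

/-- The squared Frobenius norm. -/
def frobSq {α β : Type*} [Fintype α] [Fintype β] (M : Matrix α β ℝ) : ℝ := ∑ i, ∑ j, M i j ^ 2

/-! ### Algebra of the squared Frobenius norm. -/

section FrobSq

variable {α β γ : Type*} [Fintype α] [Fintype β] [Fintype γ]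

lemma frobSq_nonneg (M : Matrix α β ℝ) : 0 ≤ frobSq M :=
  Finset.sum_nonneg fun _ _ => Finset.sum_nonneg fun _ _ => sq_nonneg _

lemma frobNorm_eq_sqrt_frobSq {m n : ℕ} (M : Matrix (Fin m) (Fin n) ℝ) :
    frobNorm M = Real.sqrt (frobSq M) := rfl

lemma frobSq_eq_trace (M : Matrix α β ℝ) : frobSq M = (Mᵀ * M).trace := by
  simp only [frobSq, Matrix.trace, Matrix.diag, Matrix.mul_apply, Matrix.transpose_apply]
  rw [Finset.sum_comm]
  simp only [sq]

lemma frobSq_add_le (M N : Matrix α β ℝ) : frobSq (M + N) ≤ 2 * frobSq M + 2 * frobSq N := by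
  simp only [frobSq, Finset.mul_sum, ← Finset.sum_add_distrib]
  gcongr with i _ j _
  simp only [Matrix.add_apply]
  nlinarith [sq_nonneg (M i j - N i j)]

lemma frobSq_smul (c : ℝ) (M : Matrix α β ℝ) : frobSq (c • M) = c ^ 2 * frobSq M := by
  simp [frobSq, Finset.mul_sum, mul_pow]

lemma frobSq_neg (M : Matrix α β ℝ) : frobSq (-M) = frobSq M := by
  simp [frobSq]

lemma frobSq_transpose (M : Matrix α β ℝ) : frobSq Mᵀ = frobSq M := by
  simp only [frobSq, Matrix.transpose_apply]
  exact Finset.sum_comm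

lemma frobSq_fromRows (M : Matrix α γ ℝ) (N : Matrix β γ ℝ) :
    frobSq (Matrix.fromRows M N) = frobSq M + frobSq N := by
  simp [frobSq, Fintype.sum_sum_type]

lemma frobSq_submatrix_equiv (M : Matrix α γ ℝ) (e : β ≃ α) :
    frobSq (M.submatrix e id) = frobSq M := by
  simp only [frobSq, Matrix.submatrix_apply, id]
  exact Equiv.sum_comp e fun i => ∑ j, M i j ^ 2

end FrobSq

/-! ### Inverse stereographic projection into the Stiefel manifold. -/

section Stereographic

variable {m k : Type*} [Fintype m] [Fintype k] [DecidableEq k]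

lemma isUnit_det_one_add_gram (X : Matrix m k ℝ) : IsUnit (1 + Xᵀ * X).det := by
  have h : (1 + Xᵀ * X).PosDef := by
    have := Matrix.posSemidef_conjTranspose_mul_self X
    rw [Matrix.conjTranspose_eq_transpose_of_trivial] at this
    exact Matrix.PosDef.one.add_posSemidef this
  exact h.det_pos.ne'.isUnit

/-- The resolvent `(1 + Xᵀ X)⁻¹`. -/
noncomputable def gramResolvent (X : Matrix m k ℝ) : Matrix k k ℝ := (1 + Xᵀ * X)⁻¹

lemma gramResolvent_transpose (X : Matrix m k ℝ) : (gramResolvent X)ᵀ = gramResolvent X := by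
  simp [gramResolvent, Matrix.transpose_nonsing_inv, Matrix.transpose_mul]

lemma gram_mul_gramResolvent (X : Matrix m k ℝ) :
    Xᵀ * X * gramResolvent X = 1 - gramResolvent X := by
  have h := Matrix.mul_nonsing_inv _ (isUnit_det_one_add_gram X)
  rw [add_mul, one_mul] at h
  exact eq_sub_of_add_eq' h

/-- The inverse stereographic projection into the Stiefel manifold. -/
noncomputable def stereographic (X : Matrix m k ℝ) : Matrix (k ⊕ m) k ℝ :=
  Matrix.fromRows (2 • gramResolvent X - 1) (2 • (X * gramResolvent X))

lemma stereographic_transpose_mul_self (X : Matrix m k ℝ) :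
    (stereographic X)ᵀ * stereographic X = 1 := by
  have hP := gram_mul_gramResolvent X
  have hT := gramResolvent_transpose X
  have h1 : (X * gramResolvent X)ᵀ * (X * gramResolvent X)
      = gramResolvent X * (1 - gramResolvent X) := by
    rw [Matrix.transpose_mul, hT, ← hP]
    simp only [Matrix.mul_assoc]
  rw [stereographic, Matrix.transpose_fromRows, Matrix.fromCols_mul_fromRows,
    Matrix.transpose_smul, Matrix.smul_mul, Matrix.mul_smul, h1, Matrix.transpose_sub,
    Matrix.transpose_smul, hT, Matrix.transpose_one]
  noncomm_ring

/-- With P = XᵀX and S = 1 - (1 + P)⁻¹ one has P = S + PS. Expanding ‖P‖², the cross term is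
tr(SᵀPS) = ‖XS‖², which appears twice among nonnegative terms. -/
lemma frobSq_mul_gram_mul_gramResolvent_le (X : Matrix m k ℝ) :
    frobSq (X * (1 - gramResolvent X)) ≤ frobSq (Xᵀ * X) := by
  set P := Xᵀ * X with hPdef
  set S := 1 - gramResolvent X with hS
  have hPS : P = S + P * S := by
    have := gram_mul_gramResolvent X
    rw [hS, mul_sub, mul_one, this]
    abel
  have hPT : Pᵀ = P := by simp [hPdef, Matrix.transpose_mul]
  have h1 : frobSq P = frobSq S + 2 * frobSq (X * S) + frobSq (P * S) := by
    conv_lhs => rw [hPS]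
    simp only [frobSq_eq_trace, Matrix.transpose_add, Matrix.transpose_mul, hPT, add_mul, mul_add,
      Matrix.trace_add]
    have e1 : Sᵀ * P * S = Sᵀ * (P * S) := Matrix.mul_assoc _ _ _
    have e2 : Sᵀ * Xᵀ * (X * S) = Sᵀ * (P * S) := by
      rw [hPdef]; simp only [Matrix.mul_assoc]
    rw [e1, e2]
    ring
  linarith [frobSq_nonneg S, frobSq_nonneg (X * S), frobSq_nonneg (P * S)]

/-- The lower block of the projection is 2X minus the error 2X(1 - (1 + XᵀX)⁻¹), and the previous
lemma makes this error quadratic in X. Distances between small matrices therefore survive the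
projection. -/
lemma four_mul_frobSq_sub_le_stereographic (X Y : Matrix m k ℝ) :
    4 * frobSq (X - Y) ≤ 2 * frobSq (stereographic X - stereographic Y)
      + 16 * (frobSq (Xᵀ * X) + frobSq (Yᵀ * Y)) := by
  have hX := frobSq_mul_gram_mul_gramResolvent_le X
  have hY := frobSq_mul_gram_mul_gramResolvent_le Y
  set A := X * (1 - gramResolvent X) with hA
  set B := Y * (1 - gramResolvent Y) with hB
  set D := (2 : ℕ) • (X * gramResolvent X) - (2 : ℕ) • (Y * gramResolvent Y) with hD
  have h1 : (2 : ℝ) • (X - Y) = D + (2 : ℝ) • (A + -B) := by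
    rw [hD, hA, hB, Matrix.mul_sub, Matrix.mul_sub, Matrix.mul_one, Matrix.mul_one]
    module
  have h2 := frobSq_add_le D ((2 : ℝ) • (A + -B))
  rw [← h1, frobSq_smul, frobSq_smul] at h2
  have h3 := frobSq_add_le A (-B)
  rw [frobSq_neg] at h3
  have h4 : frobSq D ≤ frobSq (stereographic X - stereographic Y) := by
    have : stereographic X - stereographic Y
        = Matrix.fromRows ((2 • gramResolvent X - 1) - (2 • gramResolvent Y - 1)) D := by
      ext (i | i) j <;> simp [stereographic, hD]
    rw [this, frobSq_fromRows]
    linarith [frobSq_nonneg ((2 • gramResolvent X - 1) - (2 • gramResolvent Y - 1))]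
  linarith

end Stereographic

/-! ### A Gilbert–Varshamov bound over an alphabet of 256 letters. -/

section GilbertVarshamov

variable {ι V : Type*} [Fintype ι] [DecidableEq ι] [Fintype V] [DecidableEq V]

/-- The weight is a product over coordinates, so the generating function of Hamming distances
factorizes. -/
lemma sum_pow_hammingDist (x : ι → V) (s : ℝ) :
    ∑ y : ι → V, s ^ hammingDist x y = (1 + (Fintype.card V - 1) * s) ^ Fintype.card ι := by
  have h1 : ∀ y : ι → V, s ^ hammingDist x y = ∏ i, (if x i ≠ y i then s else 1) := by
    intro y
    rw [Finset.prod_ite, Finset.prod_const, Finset.prod_const_one, mul_one, hammingDist]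
  have h2 : ∀ i, ∑ v : V, (if x i ≠ v then s else 1) = 1 + (Fintype.card V - 1) * s := by
    intro i
    have : ∀ v : V, (if x i ≠ v then s else 1) = s + if x i = v then 1 - s else 0 := by
      intro v; split_ifs <;> simp_all
    simp only [this, Finset.sum_add_distrib, Finset.sum_const, Finset.card_univ, nsmul_eq_mul,
      Finset.sum_ite_eq, Finset.mem_univ, if_true]
    ring
  simp only [h1]
  rw [← Fintype.prod_sum fun i v => if x i ≠ v then s else 1]
  simp only [h2, Finset.prod_const, Finset.card_univ]

/-- A Chernoff bound: at s = 1/256 the generating function is at most 2^N, while each point within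
distance N/2 contributes at least 16^(-N). -/
lemma card_hamming_ball_le (hV : Fintype.card V = 256) (x : ι → V) :
    (Finset.univ.filter fun y : ι → V => 2 * hammingDist x y ≤ Fintype.card ι).card
      ≤ 32 ^ Fintype.card ι := by
  set N := Fintype.card ι
  have h := sum_pow_hammingDist x (1 / 256)
  rw [hV] at h
  have h1 : ((Finset.univ.filter fun y : ι → V => 2 * hammingDist x y ≤ N).card : ℝ)
      * (1 / 16) ^ N ≤ ∑ y : ι → V, (1 / 256 : ℝ) ^ hammingDist x y := by
    rw [← nsmul_eq_mul]
    refine (Finset.card_nsmul_le_sum _ (fun y => (1 / 256 : ℝ) ^ hammingDist x y) _ ?_).trans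
      (Finset.sum_le_sum_of_subset_of_nonneg (Finset.filter_subset _ _) fun _ _ _ => by positivity)
    intro y hy
    have hy' := (Finset.mem_filter.1 hy).2
    rw [show (1 / 256 : ℝ) = (1 / 16) ^ 2 by norm_num, ← pow_mul]
    exact pow_le_pow_of_le_one (by norm_num) (by norm_num) hy'
  have h2 : (1 + ((256 : ℕ) - 1 : ℝ) * (1 / 256)) ^ N ≤ 2 ^ N := by
    gcongr; norm_num
  have h3 : ((Finset.univ.filter fun y : ι → V => 2 * hammingDist x y ≤ N).card : ℝ) ≤ 32 ^ N := by
    have h4 := (h1.trans h.le).trans h2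
    rw [div_pow, one_pow, mul_one_div, div_le_iff₀ (by positivity), ← mul_pow] at h4
    norm_num at h4
    exact h4
  exact_mod_cast h3

/-- A separated subset of `G` of maximal cardinality has balls covering `G`; otherwise an uncovered
point could be added. -/
lemma exists_hamming_code (hV : Fintype.card V = 256) (G : Finset (ι → V)) :
    ∃ P ⊆ G, (∀ x ∈ P, ∀ y ∈ P, x ≠ y → Fintype.card ι < 2 * hammingDist x y) ∧
      G.card ≤ P.card * 32 ^ Fintype.card ι := by
  classical
  set F := G.powerset.filter fun P =>
    ∀ x ∈ P, ∀ y ∈ P, x ≠ y → Fintype.card ι < 2 * hammingDist x y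
  have hF : F.Nonempty := ⟨∅, by simp [F]⟩
  obtain ⟨P, hP, hmax⟩ := F.exists_max_image Finset.card hF
  obtain ⟨hPG, hsep⟩ := Finset.mem_filter.1 hP
  rw [Finset.mem_powerset] at hPG
  refine ⟨P, hPG, hsep, ?_⟩
  have hcover : G ⊆ P.biUnion fun x =>
      Finset.univ.filter fun y : ι → V => 2 * hammingDist x y ≤ Fintype.card ι := by
    intro y hy
    by_contra hcon
    simp only [Finset.mem_biUnion, Finset.mem_filter, Finset.mem_univ, true_and, not_exists,
      not_and, not_le] at hcon
    have hyP : y ∉ P := fun h => by simpa using hcon y h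
    have : insert y P ∈ F := by
      refine Finset.mem_filter.2 ⟨Finset.mem_powerset.2 (Finset.insert_subset hy hPG), ?_⟩
      intro a ha b hb hab
      rcases Finset.mem_insert.1 ha with ha' | ha' <;>
        rcases Finset.mem_insert.1 hb with hb' | hb'
      · exact absurd (ha'.trans hb'.symm) hab
      · rw [ha', hammingDist_comm]; exact hcon b hb'
      · rw [hb']; exact hcon a ha'
      · exact hsep a ha' b hb' hab
    have := hmax _ this
    rw [Finset.card_insert_of_notMem hyP] at this
    omega
  calc G.card ≤ _ := Finset.card_le_card hcover
    _ ≤ _ := Finset.card_biUnion_le_card_mul _ _ _ fun x _ => card_hamming_ball_le hV x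

end GilbertVarshamov

/-! ### Matrices with equispaced entries and typically small off-diagonal Gram entries. -/

section Levels

/-- The `256` equispaced levels, symmetric about `0`. -/
noncomputable def level (v : Fin 256) : ℝ := v - 255 / 2

lemma level_rev (v : Fin 256) : level v.rev = -level v := by
  have : v.val + v.rev.val = 255 := by simp [Fin.val_rev]; omega
  have h : (v.val : ℝ) + v.rev.val = 255 := by exact_mod_cast this
  simp only [level]; linarith

lemma level_sq_le (v : Fin 256) : level v ^ 2 ≤ 128 ^ 2 := by
  have h : (v.val : ℝ) ≤ 255 := by exact_mod_cast Nat.lt_succ_iff.1 v.2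
  have h0 : (0 : ℝ) ≤ v.val := by positivity
  simp only [level]
  nlinarith

lemma one_le_level_sub_sq {v w : Fin 256} (h : v ≠ w) : 1 ≤ (level v - level w) ^ 2 := by
  have h1 : (1 : ℤ) ≤ ((v.val : ℤ) - w.val) ^ 2 := by
    have : (v.val : ℤ) - w.val ≠ 0 := by
      intro h'; apply h; ext; omega
    exact (sq_pos_of_ne_zero this)
  have h2 : (1 : ℝ) ≤ ((v.val : ℝ) - w.val) ^ 2 := by exact_mod_cast h1
  simp only [level]
  convert h2 using 2
  ring

/-- The matrix with the given levels as entries. -/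
noncomputable def levelMatrix {m k : ℕ} (x : Fin m × Fin k → Fin 256) : Matrix (Fin m) (Fin k) ℝ :=
  Matrix.of fun a i => level (x (a, i))

variable {m k : ℕ}

/-- Reversing the level at the single entry (a, i) is a bijection that flips the sign of the
summand, because that entry occurs exactly once in it. -/
lemma sum_level_cross_eq_zero {a b : Fin m} {i j : Fin k} (hab : a ≠ b) (hij : i ≠ j) :
    ∑ x : Fin m × Fin k → Fin 256,
      level (x (a, i)) * level (x (a, j)) * (level (x (b, i)) * level (x (b, j))) = 0 := by
  classical
  let e : (Fin m × Fin k → Fin 256) ≃ (Fin m × Fin k → Fin 256) :=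
    Equiv.piCongrRight fun p => if p = (a, i) then Fin.revPerm else Equiv.refl _
  have he : ∀ x p, e x p = if p = (a, i) then (x p).rev else x p := by
    intro x p
    simp only [e, Equiv.piCongrRight_apply, Pi.map_apply]
    split_ifs <;> simp
  have h := Equiv.sum_comp e fun x : Fin m × Fin k → Fin 256 =>
    level (x (a, i)) * level (x (a, j)) * (level (x (b, i)) * level (x (b, j)))
  have h1 : ∀ x, level (e x (a, i)) * level (e x (a, j))
      * (level (e x (b, i)) * level (e x (b, j)))
      = -(level (x (a, i)) * level (x (a, j)) * (level (x (b, i)) * level (x (b, j)))) := by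
    intro x
    rw [he, he, he, he, if_pos rfl, if_neg (by simp [hij.symm]), if_neg (by simp [hab.symm]),
      if_neg (by simp [hab.symm]), level_rev]
    ring
  simp only [h1, Finset.sum_neg_distrib] at h
  linarith

lemma level_quadruple_le (v w v' w' : Fin 256) :
    level v * level w * (level v' * level w') ≤ 128 ^ 4 := by
  have := level_sq_le v
  have := level_sq_le w
  have := level_sq_le v'
  have := level_sq_le w'
  have h1 : level v * level w ≤ 128 ^ 2 := by nlinarith [sq_nonneg (level v - level w)]
  have h2 : -(128 ^ 2) ≤ level v * level w := by nlinarith [sq_nonneg (level v + level w)]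
  have h3 : level v' * level w' ≤ 128 ^ 2 := by nlinarith [sq_nonneg (level v' - level w')]
  have h4 : -(128 ^ 2) ≤ level v' * level w' := by nlinarith [sq_nonneg (level v' + level w')]
  nlinarith

lemma gram_levelMatrix_sq (x : Fin m × Fin k → Fin 256) (i j : Fin k) :
    ((levelMatrix x)ᵀ * levelMatrix x) i j ^ 2 = ∑ a, ∑ b,
      level (x (a, i)) * level (x (a, j)) * (level (x (b, i)) * level (x (b, j))) := by
  rw [sq, Matrix.mul_apply, Finset.sum_mul_sum]
  rfl

/-- A second-moment computation: only quadruples with i = j or a = b survive averaging, at most km²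
+ k²m ≤ 2km² of them. This beats the trivial count k²m² and makes the Gram norm harmless after
scaling. -/
lemma sum_frobSq_gram_levelMatrix_le (hkm : k ≤ m) :
    ∑ x : Fin m × Fin k → Fin 256, frobSq ((levelMatrix x)ᵀ * levelMatrix x)
      ≤ 256 ^ (m * k) * (2 * k * m ^ 2 * 128 ^ 4) := by
  classical
  have hcard : Fintype.card (Fin m × Fin k → Fin 256) = 256 ^ (m * k) := by simp
  have h1 : ∑ x : Fin m × Fin k → Fin 256, frobSq ((levelMatrix x)ᵀ * levelMatrix x)
      = ∑ i, ∑ j, ∑ a, ∑ b, ∑ x : Fin m × Fin k → Fin 256,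
        level (x (a, i)) * level (x (a, j)) * (level (x (b, i)) * level (x (b, j))) := by
    simp only [frobSq, gram_levelMatrix_sq]
    rw [Finset.sum_comm]
    refine Finset.sum_congr rfl fun i _ => ?_
    rw [Finset.sum_comm]
    refine Finset.sum_congr rfl fun j _ => ?_
    rw [Finset.sum_comm]
    refine Finset.sum_congr rfl fun a _ => ?_
    rw [Finset.sum_comm]
  have h2 : ∀ (i j : Fin k) (a b : Fin m), ∑ x : Fin m × Fin k → Fin 256,
        level (x (a, i)) * level (x (a, j)) * (level (x (b, i)) * level (x (b, j)))
      ≤ (256 : ℝ) ^ (m * k) * 128 ^ 4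
        * ((if i = j then (1 : ℝ) else 0) + (if a = b then 1 else 0)) := by
    intro i j a b
    by_cases hc : i ≠ j ∧ a ≠ b
    · rw [sum_level_cross_eq_zero hc.2 hc.1]
      positivity
    · have h3 : ∑ x : Fin m × Fin k → Fin 256,
          level (x (a, i)) * level (x (a, j)) * (level (x (b, i)) * level (x (b, j)))
          ≤ (256 : ℝ) ^ (m * k) * 128 ^ 4 := by
        refine (Finset.sum_le_card_nsmul _ _ _ fun x _ => level_quadruple_le _ _ _ _).trans ?_
        rw [Finset.card_univ, hcard, nsmul_eq_mul]
        push_cast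
        exact le_rfl
      refine h3.trans (le_mul_of_one_le_right (by positivity) ?_)
      split_ifs <;> simp_all
  rw [h1]
  calc _ ≤ ∑ i : Fin k, ∑ j : Fin k, ∑ a : Fin m, ∑ b : Fin m, (256 : ℝ) ^ (m * k) * 128 ^ 4
        * ((if i = j then (1 : ℝ) else 0) + (if a = b then 1 else 0)) := by
        gcongr; exact h2 _ _ _ _
    _ = (256 : ℝ) ^ (m * k) * 128 ^ 4 * (k * m ^ 2 + k ^ 2 * m) := by
        simp only [← Finset.mul_sum, Finset.sum_add_distrib]
        simp
        ring
    _ ≤ 256 ^ (m * k) * (2 * k * m ^ 2 * 128 ^ 4) := by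
        have hkm' : (k : ℝ) ≤ m := by exact_mod_cast hkm
        have : (k : ℝ) ^ 2 * m ≤ k * m ^ 2 := by
          have : (0 : ℝ) ≤ k * m := by positivity
          nlinarith
        calc _ ≤ (256 : ℝ) ^ (m * k) * 128 ^ 4 * (k * m ^ 2 + k * m ^ 2) := by gcongr
          _ = _ := by ring

/-- Markov's inequality at twice the mean bound: at least half of all level matrices are good. -/
lemma card_good_levels (hk : 1 ≤ k) (hkm : k ≤ m) :
    256 ^ (m * k) ≤ 2 * (Finset.univ.filter fun x : Fin m × Fin k → Fin 256 =>
      frobSq ((levelMatrix x)ᵀ * levelMatrix x) ≤ 4 * k * m ^ 2 * 128 ^ 4).card := by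
  classical
  have hcard : Fintype.card (Fin m × Fin k → Fin 256) = 256 ^ (m * k) := by simp
  set p : (Fin m × Fin k → Fin 256) → Prop :=
    fun x => frobSq ((levelMatrix x)ᵀ * levelMatrix x) ≤ 4 * k * m ^ 2 * 128 ^ 4 with hp
  change 256 ^ (m * k) ≤ 2 * (Finset.univ.filter p).card
  have hsplit := Finset.card_filter_add_card_filter_not (s := Finset.univ) p
  rw [Finset.card_univ, hcard] at hsplit
  have hbad : ((Finset.univ.filter fun x => ¬ p x).card : ℝ) * (4 * k * m ^ 2 * 128 ^ 4)
      ≤ 256 ^ (m * k) * (2 * k * m ^ 2 * 128 ^ 4) := by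
    rw [← nsmul_eq_mul]
    refine le_trans ?_ (sum_frobSq_gram_levelMatrix_le hkm)
    refine (Finset.card_nsmul_le_sum _
      (fun x => frobSq ((levelMatrix x)ᵀ * levelMatrix x)) _ ?_).trans
      (Finset.sum_le_sum_of_subset_of_nonneg (Finset.filter_subset _ _)
        fun _ _ _ => frobSq_nonneg _)
    intro x hx
    exact (not_le.1 (Finset.mem_filter.1 hx).2).le
  have hpos : (0 : ℝ) < 2 * k * m ^ 2 * 128 ^ 4 := by
    have : 0 < k := hk
    have : 0 < m := hk.trans hkm
    positivity
  have hbad' : 2 * ((Finset.univ.filter fun x => ¬ p x).card : ℝ) ≤ 256 ^ (m * k) := by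
    refine le_of_mul_le_mul_right ?_ hpos
    linarith
  have hbad'' : 2 * (Finset.univ.filter fun x => ¬ p x).card ≤ 256 ^ (m * k) := by
    exact_mod_cast hbad'
  omega

lemma hammingDist_le_frobSq_levelMatrix_sub (x y : Fin m × Fin k → Fin 256) :
    (hammingDist x y : ℝ) ≤ frobSq (levelMatrix x - levelMatrix y) := by
  have h : (hammingDist x y : ℝ) = ∑ p, if x p ≠ y p then (1 : ℝ) else 0 := by
    rw [hammingDist, Finset.sum_boole]
  rw [h, frobSq, Fintype.sum_prod_type]
  gcongr with a _ i _
  simp only [levelMatrix, Matrix.sub_apply, Matrix.of_apply]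
  split_ifs with hne
  · exact one_le_level_sub_sq hne
  · positivity

end Levels

/-- The constant of the packings. -/
noncomputable def packingConst : ℝ := 2 ^ 19

/-- The scale t balances the linear term against the quadratic error. The code gives 4‖tX - tY‖² ≥
k/2^35, the Gram errors total at most k/2^37, and the remaining 3k/2^37 exceeds 2k/2^38, which is
twice k divided by the squared packing constant. -/
lemma frobSq_stereographic_sub_gt {m k : ℕ} (hk : 1 ≤ k)
    {x y : Fin m × Fin k → Fin 256}
    (hx : frobSq ((levelMatrix x)ᵀ * levelMatrix x) ≤ 4 * k * m ^ 2 * 128 ^ 4)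
    (hy : frobSq ((levelMatrix y)ᵀ * levelMatrix y) ≤ 4 * k * m ^ 2 * 128 ^ 4)
    (hxy : m * k < 2 * hammingDist x y) {t : ℝ} (ht : t ^ 2 * m = 1 / 2 ^ 36) :
    k / packingConst ^ 2 < frobSq (stereographic (t • levelMatrix x)
      - stereographic (t • levelMatrix y)) := by
  have h := four_mul_frobSq_sub_le_stereographic (t • levelMatrix x) (t • levelMatrix y)
  have hgram : ∀ z : Fin m × Fin k → Fin 256,
      frobSq ((levelMatrix z)ᵀ * levelMatrix z) ≤ 4 * k * m ^ 2 * 128 ^ 4 →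
      frobSq ((t • levelMatrix z)ᵀ * (t • levelMatrix z)) ≤ 4 * k * 128 ^ 4 / 2 ^ 72 := by
    intro z hz
    rw [Matrix.transpose_smul, Matrix.smul_mul, Matrix.mul_smul, frobSq_smul, frobSq_smul]
    calc t ^ 2 * (t ^ 2 * _) ≤ t ^ 2 * (t ^ 2 * (4 * k * m ^ 2 * 128 ^ 4)) := by gcongr
      _ = (t ^ 2 * m) ^ 2 * (4 * k * 128 ^ 4) := by ring
      _ = _ := by rw [ht]; ring
  have h1 := hgram x hx
  have h2 := hgram y hy
  rw [← smul_sub, frobSq_smul] at h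
  have h3 := hammingDist_le_frobSq_levelMatrix_sub x y
  have h4 : (m * k : ℝ) < 2 * hammingDist x y := by exact_mod_cast hxy
  have h5 : t ^ 2 * (m * k / 2) ≤ t ^ 2 * frobSq (levelMatrix x - levelMatrix y) := by
    gcongr; linarith
  have h6 : t ^ 2 * (m * k / 2) = k / 2 ^ 37 := by
    rw [show t ^ 2 * (m * k / 2) = (t ^ 2 * m) * k / 2 by ring, ht]; ring
  have hk' : (1 : ℝ) ≤ (k : ℝ) := by exact_mod_cast hk
  simp only [packingConst]
  by_contra! hcon
  linarith

theorem exists_stiefelPacking {d k : ℕ} (hk : 1 ≤ k) (hkd : 2 * k ≤ d) :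
    ∃ P : Finset (Matrix (Fin d) (Fin k) ℝ), IsStiefelPacking packingConst P := by
  classical
  obtain ⟨m, rfl⟩ : ∃ m, d = k + m := ⟨d - k, by omega⟩
  have hkm : k ≤ m := by omega
  have hm : 1 ≤ m := hk.trans hkm
  obtain ⟨P, hPG, hsep, hcard⟩ := exists_hamming_code (by simp)
    (Finset.univ.filter fun x : Fin m × Fin k → Fin 256 =>
      frobSq ((levelMatrix x)ᵀ * levelMatrix x) ≤ 4 * k * m ^ 2 * 128 ^ 4)
  have hgood := card_good_levels hk hkm
  have hN : Fintype.card (Fin m × Fin k) = m * k := by simp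
  rw [hN] at hsep hcard
  have hm0 : (0 : ℝ) < m := by exact_mod_cast hm
  set t : ℝ := Real.sqrt (1 / 2 ^ 36 / m)
  have ht : t ^ 2 * m = 1 / 2 ^ 36 := by
    rw [Real.sq_sqrt (by positivity)]; field_simp
  set Φ : (Fin m × Fin k → Fin 256) → Matrix (Fin (k + m)) (Fin k) ℝ := fun x =>
    (stereographic (t • levelMatrix x)).submatrix finSumFinEquiv.symm id
  have hΦ : ∀ x ∈ P, ∀ y ∈ P, x ≠ y → k / packingConst ^ 2 < frobSq (Φ x - Φ y) := by
    intro x hx y hy hxy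
    have := frobSq_stereographic_sub_gt hk (Finset.mem_filter.1 (hPG hx)).2
      (Finset.mem_filter.1 (hPG hy)).2 (hsep x hx y hy hxy) ht
    rwa [← frobSq_submatrix_equiv _ finSumFinEquiv.symm] at this
  have hk0 : (0 : ℝ) ≤ k / packingConst ^ 2 := by positivity
  have hinj : Set.InjOn Φ P := by
    intro x hx y hy hxy
    by_contra hne
    have := hΦ x hx y hy hne
    rw [hxy, sub_self] at this
    simp only [frobSq, Matrix.zero_apply] at this
    norm_num at this
    linarith
  refine ⟨P.image Φ, ?_, ?_, ?_⟩
  · intro Q hQ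
    obtain ⟨x, -, rfl⟩ := Finset.mem_image.1 hQ
    have := stereographic_transpose_mul_self (t • levelMatrix x)
    simp only [IsStiefel, Φ]
    rw [Matrix.transpose_submatrix, Matrix.submatrix_mul_equiv, this]
    simp
  · rw [Finset.card_image_of_injOn hinj]
    -- Hence the code has at least 8^(mk)/2 ≥ 4^(mk) words, and k(k + m) ≤ 2mk because k ≤ m. The
    -- large alphabet is what leaves room for the full exponent kd.
    have h1 : 256 ^ (m * k) ≤ 2 * (P.card * 32 ^ (m * k)) := hgood.trans (by gcongr)
    have h0 : 256 ^ (m * k) = 8 ^ (m * k) * 32 ^ (m * k) := by rw [← mul_pow]; norm_num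
    rw [h0] at h1
    have h2 : 8 ^ (m * k) ≤ 2 * P.card := by
      refine Nat.le_of_mul_le_mul_right ?_ (show 0 < 32 ^ (m * k) by positivity)
      linarith
    have h3 : 2 ^ (m * k) * 4 ^ (m * k) = 8 ^ (m * k) := by rw [← mul_pow]; norm_num
    have h4 : 2 ≤ 2 ^ (m * k) := by
      calc 2 = 2 ^ 1 := rfl
        _ ≤ 2 ^ (m * k) := Nat.pow_le_pow_right (by norm_num) (Nat.mul_pos hm hk)
    have h5 : 2 ^ (k * (k + m)) ≤ 4 ^ (m * k) := by
      rw [show 4 = 2 ^ 2 by norm_num, ← pow_mul]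
      exact Nat.pow_le_pow_right (by norm_num) (by nlinarith)
    have h6 : 2 * 4 ^ (m * k) ≤ 2 * P.card := by
      calc _ ≤ 2 ^ (m * k) * 4 ^ (m * k) := by gcongr
        _ ≤ _ := by rw [h3]; exact h2
    omega
  · intro Q hQ Q' hQ' hne
    obtain ⟨x, hx, rfl⟩ := Finset.mem_image.1 hQ
    obtain ⟨y, hy, rfl⟩ := Finset.mem_image.1 hQ'
    have h := hΦ x hx y hy fun h => hne (by rw [h])
    rw [frobNorm_eq_sqrt_frobSq]
    have hC : (0 : ℝ) < packingConst := by unfold packingConst; positivity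
    rw [show Real.sqrt k / packingConst = Real.sqrt (k / packingConst ^ 2) by
      rw [Real.sqrt_div (by positivity), Real.sqrt_sq hC.le]]
    exact Real.sqrt_lt_sqrt hk0 h

/-! ### Translation of Gaussian measures. -/

section GaussianTranslation

/-- The weight is the density ratio at x + h and x, so the identity is translation invariance of
Lebesgue measure. -/
lemma lintegral_gaussianReal_translate {v : NNReal} (hv : v ≠ 0) (h : ℝ) {f : ℝ → ℝ≥0∞}
    (hf : Measurable f) :
    ∫⁻ x, f (x + h) * ENNReal.ofReal (Real.exp (-(h * x / v + h ^ 2 / (2 * v))))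
      ∂gaussianReal 0 v = ∫⁻ x, f x ∂gaussianReal 0 v := by
  have hv' : (v : ℝ) ≠ 0 := by exact_mod_cast hv
  rw [gaussianReal_of_var_ne_zero _ hv,
    lintegral_withDensity_eq_lintegral_mul _ (measurable_gaussianPDF 0 v) hf,
    lintegral_withDensity_eq_lintegral_mul _ (measurable_gaussianPDF 0 v) (by fun_prop)]
  conv_rhs => rw [← lintegral_add_right_eq_self _ h]
  refine lintegral_congr fun x => ?_
  simp only [Pi.mul_apply, gaussianPDF]
  rw [mul_comm (f _), ← mul_assoc, ← ENNReal.ofReal_mul (gaussianPDFReal_nonneg _ _ _)]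
  congr 2
  simp only [gaussianPDFReal, sub_zero, mul_assoc, ← Real.exp_add]
  congr 2
  field_simp
  ring

lemma lintegral_pi_prod {ι : Type*} [Fintype ι] {X : ι → Type*} [∀ i, MeasurableSpace (X i)]
    (μ : ∀ i, Measure (X i)) [∀ i, IsProbabilityMeasure (μ i)] {f : ∀ i, X i → ℝ≥0∞}
    (hf : ∀ i, Measurable (f i)) :
    ∫⁻ x, ∏ i, f i (x i) ∂Measure.pi μ = ∏ i, ∫⁻ x, f i x ∂μ i := by
  rw [lintegral_prod_eq_prod_lintegral_of_indepFun Finset.univ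
    (fun i (x : ∀ i, X i) => f i (x i)) (iIndepFun_pi fun i => (hf i).aemeasurable)
    (fun i => (hf i).comp (measurable_pi_apply i))]
  refine Finset.prod_congr rfl fun i _ => ?_
  exact (measurePreserving_eval μ i).lintegral_comp (hf i)

instance instIsProbabilityMeasureGaussianNoise (σ : ℝ) (d : ℕ) :
    IsProbabilityMeasure (gaussianNoise σ d) := by
  unfold gaussianNoise; infer_instance

variable {σ : ℝ} {d : ℕ}

lemma lintegral_gaussianNoise_translate (hσ : 0 < σ) (h : Fin d → ℝ)
    {g : (Fin d → ℝ) → ℝ≥0∞} (hg : Measurable g) :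
    ∫⁻ y, g (y + h) * ENNReal.ofReal (Real.exp (-(h ⬝ᵥ y / σ ^ 2 + h ⬝ᵥ h / (2 * σ ^ 2))))
      ∂gaussianNoise σ d = ∫⁻ y, g y ∂gaussianNoise σ d := by
  have hv : (Real.toNNReal (σ ^ 2)) ≠ 0 := by
    rw [Ne, Real.toNNReal_eq_zero]; push Not; positivity
  have hv' : ((Real.toNNReal (σ ^ 2) : NNReal) : ℝ) = σ ^ 2 := Real.coe_toNNReal _ (sq_nonneg _)
  set w : (Fin d → ℝ) → ℝ≥0∞ := fun y =>
    ENNReal.ofReal (Real.exp (-(h ⬝ᵥ y / σ ^ 2 + h ⬝ᵥ h / (2 * σ ^ 2)))) with hw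
  have hwm : Measurable w := by
    simp only [hw, dotProduct]; fun_prop
  have hwprod : ∀ y, w y = ∏ i, ENNReal.ofReal
      (Real.exp (-(h i * y i / σ ^ 2 + h i ^ 2 / (2 * σ ^ 2)))) := by
    intro y
    rw [← ENNReal.ofReal_prod_of_nonneg fun _ _ => (Real.exp_pos _).le, ← Real.exp_sum,
      Finset.sum_neg_distrib, Finset.sum_add_distrib, ← Finset.sum_div, ← Finset.sum_div]
    simp only [hw, dotProduct, sq]
  have htm : Measurable fun y : Fin d → ℝ => y + h := by fun_prop
  -- The product measure is determined by boxes, on which both the indicator and the weight factor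
  -- into one-dimensional pieces.
  have hmeas : gaussianNoise σ d
      = ((gaussianNoise σ d).withDensity w).map (fun y => y + h) := by
    conv_lhs => rw [gaussianNoise]
    refine Measure.pi_eq fun s hs => ?_
    have hS : MeasurableSet (Set.univ.pi s) := MeasurableSet.univ_pi hs
    rw [Measure.map_apply htm hS, withDensity_apply _ (htm hS), ← lintegral_indicator (htm hS)]
    have h1 : ∀ y : Fin d → ℝ, ((fun y => y + h) ⁻¹' Set.univ.pi s).indicator w y
        = ∏ i, ((s i).indicator 1 (y i + h i) * ENNReal.ofReal
          (Real.exp (-(h i * y i / σ ^ 2 + h i ^ 2 / (2 * σ ^ 2))))) := by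
      intro y
      rw [Finset.prod_mul_distrib, ← hwprod]
      by_cases hy : y + h ∈ Set.univ.pi s
      · rw [Set.indicator_of_mem (by exact hy), Finset.prod_eq_one, one_mul]
        intro i _
        exact Set.indicator_of_mem (hy i (Set.mem_univ i)) _
      · rw [Set.indicator_of_notMem (by exact hy)]
        simp only [Set.mem_univ_pi, not_forall] at hy
        obtain ⟨i, hi⟩ := hy
        rw [Finset.prod_eq_zero (Finset.mem_univ i), zero_mul]
        exact Set.indicator_of_notMem hi _
    simp only [h1]
    have hm : ∀ i, Measurable fun x : ℝ => (s i).indicator (1 : ℝ → ℝ≥0∞) (x + h i)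
        * ENNReal.ofReal (Real.exp (-(h i * x / σ ^ 2 + h i ^ 2 / (2 * σ ^ 2)))) := by
      intro i
      refine Measurable.mul ?_ (by fun_prop)
      exact (measurable_one.indicator (hs i)).comp (measurable_id.add_const _)
    rw [gaussianNoise]
    refine (lintegral_pi_prod _ hm).trans ?_
    refine Finset.prod_congr rfl fun i _ => ?_
    have h2 := lintegral_gaussianReal_translate hv (h i) (measurable_one.indicator (hs i))
    rw [hv'] at h2
    rw [h2, lintegral_indicator_one (hs i)]
  have hgm : Measurable fun y => g (y + h) := hg.comp htm
  conv_rhs => rw [hmeas, lintegral_map hg htm,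
    lintegral_withDensity_eq_lintegral_mul _ hwm hgm]
  refine lintegral_congr fun y => ?_
  rw [Pi.mul_apply, mul_comm]

end GaussianTranslation

/-! ### Predictable shifts of noise and Girsanov's formula. -/

section AdaptedShift

lemma lintegral_pi_snoc {E : Type*} [MeasurableSpace E] (ν : Measure E) [IsProbabilityMeasure ν]
    {n : ℕ} {F : (Fin (n + 1) → E) → ℝ≥0∞} (hF : Measurable F) :
    ∫⁻ e, F e ∂Measure.pi (fun _ => ν)
      = ∫⁻ e, ∫⁻ x, F (Fin.snoc (α := fun _ => E) e x) ∂ν ∂Measure.pi (fun _ => ν) := by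
  have h := (measurePreserving_piFinSuccAbove (fun _ : Fin (n + 1) => ν) (Fin.last n)).symm
  have hm : Measurable fun a =>
      F ((MeasurableEquiv.piFinSuccAbove (fun _ => E) (Fin.last n)).symm a) :=
    hF.comp (MeasurableEquiv.measurable _)
  rw [← h.lintegral_comp hF, lintegral_prod_symm _ hm.aemeasurable]
  refine lintegral_congr fun e => lintegral_congr fun x => ?_
  congr 1
  simp [MeasurableEquiv.piFinSuccAbove, Fin.insertNth_last', Fin.insertNthEquiv]

/-- A predictable shift of the noise: at time `t` it depends on the observations before `t` and on
the exogenous variable at `t`. -/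
abbrev PredictableShift (Z : Type*) (d : ℕ) : Type _ :=
  ∀ t : ℕ, (Fin t → Z × (Fin d → ℝ)) → Z → Fin d → ℝ

variable {Z : Type*} {d n : ℕ}

/-- Joint measurability of every component of a predictable shift. -/
def PredictableShift.IsMeasurable [MeasurableSpace Z] (h : PredictableShift Z d) : Prop :=
  ∀ t, Measurable fun p : (Fin t → Z × (Fin d → ℝ)) × Z => h t p.1 p.2

/-- The value of the shift at time `i` along a noise sequence. -/
def PredictableShift.value (h : PredictableShift Z d) (e : Fin n → Z × (Fin d → ℝ)) (i : Fin n) :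
    Fin d → ℝ :=
  h i (fun j => e (Fin.castLE i.2.le j)) (e i).1

/-- The shifted noise sequence. -/
def PredictableShift.map (h : PredictableShift Z d) (e : Fin n → Z × (Fin d → ℝ)) (i : Fin n) :
    Z × (Fin d → ℝ) :=
  ((e i).1, (e i).2 + h.value e i)

/-- The inner product of the shift with the noise. -/
def PredictableShift.cross (h : PredictableShift Z d) (e : Fin n → Z × (Fin d → ℝ)) : ℝ :=
  ∑ i, h.value e i ⬝ᵥ (e i).2

/-- The squared length of the shift. -/
def PredictableShift.quad (h : PredictableShift Z d) (e : Fin n → Z × (Fin d → ℝ)) : ℝ :=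
  ∑ i, h.value e i ⬝ᵥ h.value e i

namespace PredictableShift

variable {h : PredictableShift Z d}

lemma value_snoc_castSucc (e : Fin n → Z × (Fin d → ℝ)) (x : Z × (Fin d → ℝ)) (i : Fin n) :
    h.value (Fin.snoc (α := fun _ => Z × (Fin d → ℝ)) e x) i.castSucc = h.value e i := by
  unfold PredictableShift.value
  have : (fun j : Fin i.castSucc.val => Fin.snoc (α := fun _ => Z × (Fin d → ℝ)) e x
      (Fin.castLE i.castSucc.2.le j)) = fun j : Fin i.val => e (Fin.castLE i.2.le j) := by
    funext j
    have : Fin.castLE i.castSucc.2.le j = (Fin.castLE i.2.le j : Fin n).castSucc := rfl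
    rw [this, Fin.snoc_castSucc]
  rw [Fin.snoc_castSucc]
  exact congrArg (fun f => h i f (e i).1) this

lemma value_snoc_last (e : Fin n → Z × (Fin d → ℝ)) (x : Z × (Fin d → ℝ)) :
    h.value (Fin.snoc (α := fun _ => Z × (Fin d → ℝ)) e x) (Fin.last n) = h n e x.1 := by
  unfold PredictableShift.value
  have : (fun j : Fin (Fin.last n).val => Fin.snoc (α := fun _ => Z × (Fin d → ℝ)) e x
      (Fin.castLE (Fin.last n).2.le j)) = e := by
    funext j
    have : Fin.castLE (Fin.last n).2.le j = Fin.castSucc (n := n) j := rfl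
    rw [this, Fin.snoc_castSucc]
  rw [Fin.snoc_last]
  exact congrArg (fun f => h n f x.1) this

lemma map_snoc (e : Fin n → Z × (Fin d → ℝ)) (x : Z × (Fin d → ℝ)) :
    h.map (Fin.snoc (α := fun _ => Z × (Fin d → ℝ)) e x)
      = Fin.snoc (α := fun _ => Z × (Fin d → ℝ)) (h.map e) (x.1, x.2 + h n e x.1) := by
  funext i
  refine Fin.lastCases ?_ (fun i => ?_) i
  · simp only [PredictableShift.map, value_snoc_last, Fin.snoc_last]
  · simp only [PredictableShift.map, value_snoc_castSucc, Fin.snoc_castSucc]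

lemma cross_snoc (e : Fin n → Z × (Fin d → ℝ)) (x : Z × (Fin d → ℝ)) :
    h.cross (Fin.snoc (α := fun _ => Z × (Fin d → ℝ)) e x)
      = h.cross e + h n e x.1 ⬝ᵥ x.2 := by
  simp only [PredictableShift.cross, Fin.sum_univ_castSucc, value_snoc_castSucc, value_snoc_last,
    Fin.snoc_castSucc, Fin.snoc_last]

lemma quad_snoc (e : Fin n → Z × (Fin d → ℝ)) (x : Z × (Fin d → ℝ)) :
    h.quad (Fin.snoc (α := fun _ => Z × (Fin d → ℝ)) e x)
      = h.quad e + h n e x.1 ⬝ᵥ h n e x.1 := by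
  simp only [PredictableShift.quad, Fin.sum_univ_castSucc, value_snoc_castSucc, value_snoc_last]

variable [MeasurableSpace Z]

lemma measurable_value (hh : h.IsMeasurable) (i : Fin n) :
    Measurable fun e : Fin n → Z × (Fin d → ℝ) => h.value e i :=
  (hh i).comp (Measurable.prodMk (by fun_prop) (by fun_prop))

lemma measurable_map (hh : h.IsMeasurable) :
    Measurable fun e : Fin n → Z × (Fin d → ℝ) => h.map e := by
  refine measurable_pi_lambda _ fun i => Measurable.prodMk (by fun_prop) ?_
  exact Measurable.add (by fun_prop) (measurable_value hh i)

lemma measurable_cross (hh : h.IsMeasurable) :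
    Measurable fun e : Fin n → Z × (Fin d → ℝ) => h.cross e := by
  refine Finset.measurable_sum _ fun i _ => Finset.measurable_sum _ fun j _ => ?_
  exact ((measurable_pi_apply j).comp (measurable_value hh i)).mul (by fun_prop)

lemma measurable_quad (hh : h.IsMeasurable) :
    Measurable fun e : Fin n → Z × (Fin d → ℝ) => h.quad e := by
  refine Finset.measurable_sum _ fun i _ => Finset.measurable_sum _ fun j _ => ?_
  exact ((measurable_pi_apply j).comp (measurable_value hh i)).mul
    ((measurable_pi_apply j).comp (measurable_value hh i))

/-- Girsanov's formula for a predictable shift of Gaussian noise. -/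
theorem lintegral_comp_map {σ : ℝ} (hσ : 0 < σ) (μ : Measure Z) [IsProbabilityMeasure μ]
    (hh : h.IsMeasurable) {g : (Fin n → Z × (Fin d → ℝ)) → ℝ≥0∞} (hg : Measurable g) :
    ∫⁻ e, g (h.map e) * ENNReal.ofReal
        (Real.exp (-(h.cross e / σ ^ 2 + h.quad e / (2 * σ ^ 2))))
        ∂Measure.pi (fun _ => μ.prod (gaussianNoise σ d))
      = ∫⁻ e, g e ∂Measure.pi (fun _ => μ.prod (gaussianNoise σ d)) := by
  induction n with
  | zero =>
    refine lintegral_congr fun e => ?_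
    rw [Subsingleton.elim (h.map e) e]
    simp [PredictableShift.cross, PredictableShift.quad]
  | succ n ih =>
    have hmF : Measurable fun e : Fin (n + 1) → Z × (Fin d → ℝ) =>
        g (h.map e) * ENNReal.ofReal
        (Real.exp (-(h.cross e / σ ^ 2 + h.quad e / (2 * σ ^ 2)))) := by
      have h1 := measurable_map (n := n + 1) hh
      have h2 := measurable_cross (n := n + 1) hh
      have h3 := measurable_quad (n := n + 1) hh
      fun_prop
    have hsnoc : Measurable fun p : (Fin n → Z × (Fin d → ℝ)) × (Z × (Fin d → ℝ)) =>
        (Fin.snoc (α := fun _ => Z × (Fin d → ℝ)) p.1 p.2 : Fin (n + 1) → Z × (Fin d → ℝ)) := by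
      refine measurable_pi_lambda _ fun i => ?_
      refine Fin.lastCases ?_ (fun i => ?_) i
      · simp only [Fin.snoc_last]; fun_prop
      · simp only [Fin.snoc_castSucc]; fun_prop
    have hG : Measurable fun e : Fin n → Z × (Fin d → ℝ) =>
        ∫⁻ x, g (Fin.snoc (α := fun _ => Z × (Fin d → ℝ)) e x) ∂μ.prod (gaussianNoise σ d) :=
      (hg.comp hsnoc).lintegral_prod_right'
    -- The induction hypothesis is applied to `g` with its last coordinate integrated out. It
    -- remains to match the inner integrals with the past fixed.
    rw [lintegral_pi_snoc _ hmF, lintegral_pi_snoc _ hg, ← ih hG]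
    refine lintegral_congr fun e => ?_
    have hge : Measurable fun x => g (Fin.snoc (α := fun _ => Z × (Fin d → ℝ)) (h.map e) x) :=
      (hg.comp hsnoc).comp (measurable_const.prodMk measurable_id)
    have hn : Measurable fun z => h n e z :=
      (hh n).comp (measurable_const.prodMk measurable_id)
    have hn' : ∀ i, Measurable fun z => h n e z i := fun i => (measurable_pi_apply i).comp hn
    have hw : Measurable fun x : Z × (Fin d → ℝ) => ENNReal.ofReal (Real.exp
        (-(h n e x.1 ⬝ᵥ x.2 / σ ^ 2 + h n e x.1 ⬝ᵥ h n e x.1 / (2 * σ ^ 2)))) := by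
      simp only [dotProduct]; fun_prop
    have hgs : Measurable fun x : Z × (Fin d → ℝ) =>
        g (Fin.snoc (α := fun _ => Z × (Fin d → ℝ)) (h.map e) (x.1, x.2 + h n e x.1)) :=
      hge.comp (by fun_prop)
    have hsplit : ∀ x : Z × (Fin d → ℝ),
        g (h.map (Fin.snoc (α := fun _ => Z × (Fin d → ℝ)) e x)) * ENNReal.ofReal
          (Real.exp (-(h.cross (Fin.snoc (α := fun _ => Z × (Fin d → ℝ)) e x) / σ ^ 2
            + h.quad (Fin.snoc (α := fun _ => Z × (Fin d → ℝ)) e x) / (2 * σ ^ 2))))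
        = g (Fin.snoc (α := fun _ => Z × (Fin d → ℝ)) (h.map e) (x.1, x.2 + h n e x.1))
          * ENNReal.ofReal (Real.exp
            (-(h n e x.1 ⬝ᵥ x.2 / σ ^ 2 + h n e x.1 ⬝ᵥ h n e x.1 / (2 * σ ^ 2))))
          * ENNReal.ofReal (Real.exp (-(h.cross e / σ ^ 2 + h.quad e / (2 * σ ^ 2)))) := by
      intro x
      rw [map_snoc, cross_snoc, quad_snoc, mul_assoc, ← ENNReal.ofReal_mul (Real.exp_pos _).le,
        ← Real.exp_add]
      congr 3
      ring
    have hgw := hgs.fun_mul hw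
    simp only [hsplit]
    rw [lintegral_mul_const _ hgw]
    congr 1
    -- Once the past and the exogenous variable are frozen, the last shift is a constant vector, so
    -- plain Gaussian translation applies.
    rw [lintegral_prod _ hgw.aemeasurable, lintegral_prod _ hge.aemeasurable]
    refine lintegral_congr fun z => ?_
    exact lintegral_gaussianNoise_translate hσ (h n e z)
      (g := fun y => g (Fin.snoc (α := fun _ => Z × (Fin d → ℝ)) (h.map e) (z, y)))
      (hge.comp (by fun_prop))

end PredictableShift

end AdaptedShift

/-! ### Comparing event probabilities through the likelihood ratio. -/

section ChangeOfMeasure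

variable {Z : Type*} [MeasurableSpace Z] {d n : ℕ} {σ : ℝ} {h : PredictableShift Z d}

namespace PredictableShift

/-- An exponential supermartingale bound for the cross term of a shift. -/
lemma measureReal_cross_ge_le (hσ : 0 < σ) (μ : Measure Z) [IsProbabilityMeasure μ]
    (hh : h.IsMeasurable) {s : ℝ} (hs : 0 < s) (t : ℝ) :
    (Measure.pi fun _ : Fin n => μ.prod (gaussianNoise σ d)).real
      {e | s * (h.quad e / (2 * σ ^ 2)) + t / s ≤ h.cross e / σ ^ 2} ≤ Real.exp (-t) := by
  set P := Measure.pi fun _ : Fin n => μ.prod (gaussianNoise σ d)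
  -- Girsanov's formula for the shift -s h with test function 1 says that exp(s·cross/σ² -
  -- s²·quad/(2σ²)) has mean 1; Markov's inequality then gives the tail.
  let k : PredictableShift Z d := fun i f z => (-s) • h i f z
  have hk : k.IsMeasurable := fun i => (hh i).const_smul (-s)
  have hat : ∀ (e : Fin n → Z × (Fin d → ℝ)) i, k.value e i = (-s) • h.value e i := fun _ _ => rfl
  have hcross : ∀ e : Fin n → Z × (Fin d → ℝ), k.cross e = -s * h.cross e := by
    intro e
    simp only [PredictableShift.cross, hat, smul_dotProduct, smul_eq_mul, Finset.mul_sum]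
  have hquad : ∀ e : Fin n → Z × (Fin d → ℝ), k.quad e = s ^ 2 * h.quad e := by
    intro e
    simp only [PredictableShift.quad, hat, smul_dotProduct, dotProduct_smul, smul_eq_mul,
      Finset.mul_sum]
    exact Finset.sum_congr rfl fun _ _ => by ring
  have h1 := lintegral_comp_map hσ μ hk (n := n) (g := fun _ => 1) measurable_const
  simp only [one_mul, hcross, hquad, lintegral_one, measure_univ] at h1
  set f : (Fin n → Z × (Fin d → ℝ)) → ℝ≥0∞ := fun e => ENNReal.ofReal
    (Real.exp (-(-s * h.cross e / σ ^ 2 + s ^ 2 * h.quad e / (2 * σ ^ 2)))) with hf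
  have hfm : Measurable f := by
    have := measurable_cross (n := n) hh
    have := measurable_quad (n := n) hh
    fun_prop
  have h2 := mul_meas_ge_le_lintegral (μ := P) hfm (ENNReal.ofReal (Real.exp t))
  rw [h1] at h2
  have h3 : {e | s * (h.quad e / (2 * σ ^ 2)) + t / s ≤ h.cross e / σ ^ 2}
      ⊆ {e | ENNReal.ofReal (Real.exp t) ≤ f e} := by
    intro e he
    simp only [Set.mem_ofPred_eq, hf] at he ⊢
    refine ENNReal.ofReal_le_ofReal (Real.exp_le_exp.2 ?_)
    have := mul_le_mul_of_nonneg_left he hs.le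
    rw [mul_add, mul_div_cancel₀ _ hs.ne'] at this
    have e1 : -(-s * h.cross e / σ ^ 2 + s ^ 2 * h.quad e / (2 * σ ^ 2))
      = s * (h.cross e / σ ^ 2) - s * (s * (h.quad e / (2 * σ ^ 2))) := by ring
    linarith
  have h4 : ENNReal.ofReal (Real.exp t) * P {e | s * (h.quad e / (2 * σ ^ 2)) + t / s
      ≤ h.cross e / σ ^ 2} ≤ 1 := le_trans (by gcongr) h2
  have h5 := ENNReal.toReal_mono ENNReal.one_ne_top h4
  rw [ENNReal.toReal_mul, ENNReal.toReal_ofReal (Real.exp_pos _).le, ENNReal.toReal_one] at h5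
  rw [Real.exp_neg, ← one_div, le_div_iff₀ (Real.exp_pos _), mul_comm]
  exact h5

lemma measureReal_quad_ge_le (μ : Measure Z) [IsProbabilityMeasure μ]
    (hh : h.IsMeasurable) {K a : ℝ} (hK : 0 ≤ K) (ha : 0 < a)
    (hint : ∫⁻ e, ENNReal.ofReal (h.quad e / (2 * σ ^ 2))
      ∂Measure.pi (fun _ : Fin n => μ.prod (gaussianNoise σ d)) ≤ ENNReal.ofReal K) :
    (Measure.pi fun _ : Fin n => μ.prod (gaussianNoise σ d)).real
      {e | a ≤ h.quad e / (2 * σ ^ 2)} ≤ K / a := by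
  set P := Measure.pi fun _ : Fin n => μ.prod (gaussianNoise σ d)
  have hfm : Measurable fun e : Fin n → Z × (Fin d → ℝ) =>
      ENNReal.ofReal (h.quad e / (2 * σ ^ 2)) := by
    have := measurable_quad (n := n) hh
    fun_prop
  have h2 := (mul_meas_ge_le_lintegral (μ := P) hfm (ENNReal.ofReal a)).trans hint
  have h3 : {e | a ≤ h.quad e / (2 * σ ^ 2)}
      ⊆ {e : Fin n → Z × (Fin d → ℝ) | ENNReal.ofReal a
        ≤ ENNReal.ofReal (h.quad e / (2 * σ ^ 2))} :=
    fun e he => ENNReal.ofReal_le_ofReal he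
  have h4 : ENNReal.ofReal a * P {e | a ≤ h.quad e / (2 * σ ^ 2)} ≤ ENNReal.ofReal K :=
    le_trans (by gcongr) h2
  have h5 := ENNReal.toReal_mono ENNReal.ofReal_ne_top h4
  rw [ENNReal.toReal_mul, ENNReal.toReal_ofReal ha.le, ENNReal.toReal_ofReal hK] at h5
  rw [le_div_iff₀ ha, mul_comm]
  exact h5

end PredictableShift

/-- The law `P` keeps a fixed fraction of the probability that `P'` gives to any event, up to an
error controlled by the relative entropy bound `K`. -/
def ChangeOfMeasureBound {D : Type*} [MeasurableSpace D] (P' P : Measure D) (K : ℝ) : Prop :=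
  ∀ S, MeasurableSet S → ∀ a s t : ℝ, 0 < a → 0 < s →
    Real.exp (-(a + s * a + t / s)) * (P'.real S - K / a - Real.exp (-t)) ≤ P.real S

/-- The log-likelihood ratio is cross/σ² + quad/(2σ²). Outside an event of probability K/a the
quadratic part is below a, and outside one of probability e^(-t) the cross part is below
s·quad/(2σ²) + t/s; on the rest the Girsanov weight is at least exp(-(a + sa + t/s)). -/
theorem changeOfMeasureBound_map (hσ : 0 < σ) (μ : Measure Z) [IsProbabilityMeasure μ]
    (hh : h.IsMeasurable) {D : Type*} [MeasurableSpace D]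
    {φ φ' : (Fin n → Z × (Fin d → ℝ)) → D} (hφ : Measurable φ)
    (hφ' : ∀ e, φ' e = φ (h.map e)) {K : ℝ} (hK : 0 ≤ K)
    (hint : ∫⁻ e, ENNReal.ofReal (h.quad e / (2 * σ ^ 2))
      ∂Measure.pi (fun _ : Fin n => μ.prod (gaussianNoise σ d)) ≤ ENNReal.ofReal K) :
    ChangeOfMeasureBound ((Measure.pi fun _ : Fin n => μ.prod (gaussianNoise σ d)).map φ')
      ((Measure.pi fun _ : Fin n => μ.prod (gaussianNoise σ d)).map φ) K := by
  intro S hS a s t ha hs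
  set P := Measure.pi fun _ : Fin n => μ.prod (gaussianNoise σ d) with hP
  have hφ'm : Measurable φ' := by
    rw [funext hφ']; exact hφ.comp (PredictableShift.measurable_map hh)
  have hc := PredictableShift.measurable_cross (n := n) hh
  have hq := PredictableShift.measurable_quad (n := n) hh
  rw [map_measureReal_apply hφ hS, map_measureReal_apply hφ'm hS]
  set τ := a + s * a + t / s
  set G : Set (Fin n → Z × (Fin d → ℝ)) :=
    φ' ⁻¹' S ∩ {e | h.cross e / σ ^ 2 + h.quad e / (2 * σ ^ 2) ≤ τ}
  have hGm : MeasurableSet G :=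
    (hφ'm hS).inter (measurableSet_le (by fun_prop) measurable_const)
  have hcover : φ' ⁻¹' S ⊆ G ∪ {e | a ≤ h.quad e / (2 * σ ^ 2)}
      ∪ {e | s * (h.quad e / (2 * σ ^ 2)) + t / s ≤ h.cross e / σ ^ 2} := by
    intro e he
    by_contra hcon
    simp only [Set.mem_union, Set.mem_ofPred_eq, not_or, not_le] at hcon
    obtain ⟨⟨h1, h2⟩, h3⟩ := hcon
    refine h1 ⟨he, ?_⟩
    have := mul_le_mul_of_nonneg_left h2.le hs.le
    simp only [Set.mem_ofPred_eq, τ]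
    linarith
  have h1 : P.real (φ' ⁻¹' S) ≤ P.real G + K / a + Real.exp (-t) := by
    refine (measureReal_mono hcover).trans ((measureReal_union_le _ _).trans ?_)
    refine add_le_add ((measureReal_union_le _ _).trans ?_)
      (PredictableShift.measureReal_cross_ge_le hσ μ hh hs t)
    gcongr
    exact PredictableShift.measureReal_quad_ge_le μ hh hK ha hint
  have h2 : ENNReal.ofReal (Real.exp (-τ)) * P G ≤ P (φ ⁻¹' S) := by
    have hind : Measurable ((φ ⁻¹' S).indicator (1 : (Fin n → Z × (Fin d → ℝ)) → ℝ≥0∞)) :=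
      measurable_one.indicator (hφ hS)
    rw [← lintegral_indicator_one (hφ hS), ← PredictableShift.lintegral_comp_map hσ μ hh hind,
      ← lintegral_indicator_const hGm]
    refine lintegral_mono fun e => ?_
    by_cases he : e ∈ G
    · rw [Set.indicator_of_mem he, Set.indicator_of_mem (by
        have := he.1
        rwa [Set.mem_preimage, hφ' e] at this), Pi.one_apply, one_mul]
      refine ENNReal.ofReal_le_ofReal (Real.exp_le_exp.2 (neg_le_neg he.2))
    · rw [Set.indicator_of_notMem he]
      exact zero_le
  have h3 := ENNReal.toReal_mono (measure_ne_top _ _) h2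
  rw [ENNReal.toReal_mul, ENNReal.toReal_ofReal (Real.exp_pos _).le] at h3
  refine le_trans ?_ h3
  refine mul_le_mul_of_nonneg_left ?_ (Real.exp_pos _).le
  change _ ≤ P.real G
  linarith

end ChangeOfMeasure

/-! ### From disjoint success events to a lower bound on relative entropy. -/

section Testing

lemma exp_neg_three_le : Real.exp (-3) ≤ 1 / 10 := by
  rw [Real.exp_neg, ← one_div]
  refine one_div_le_one_div_of_le (by norm_num) ?_
  have h1 := Real.exp_one_gt_d9
  have h2 : Real.exp 3 = Real.exp 1 ^ 3 := by rw [← Real.exp_nat_mul]; norm_num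
  rw [h2]
  calc (10 : ℝ) ≤ 2.7 ^ 3 := by norm_num
    _ ≤ Real.exp 1 ^ 3 := by gcongr; linarith

/-- If K were tiny, the two laws would nearly agree, yet one event has mass at least 1/2 under one
and at most 1/4 under the other. The chosen a, s, t make the exponent 0.185 and the bracket at least
0.35, and 0.815 · 0.35 > 1/4. -/
lemma entropy_bound_ge {K p : ℝ} (hp : p ≤ 1 / 4)
    (h : ∀ a s t : ℝ, 0 < a → 0 < s →
      Real.exp (-(a + s * a + t / s)) * (1 / 2 - K / a - Real.exp (-t)) ≤ p) :
    1 / 8000 ≤ K := by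
  by_contra! hK
  have h1 := h (1 / 400) 48 3 (by norm_num) (by norm_num)
  have h2 := exp_neg_three_le
  have h3 : (1 - 0.185 : ℝ) ≤ Real.exp (-(1 / 400 + 48 * (1 / 400) + 3 / 48)) := by
    have := Real.add_one_le_exp (-(1 / 400 + 48 * (1 / 400) + 3 / 48) : ℝ)
    norm_num at this ⊢
    linarith
  have h4 : (0.35 : ℝ) ≤ 1 / 2 - K / (1 / 400) - Real.exp (-3) := by
    have : K / (1 / 400) = 400 * K := by ring
    rw [this]; norm_num; linarith
  have h5 := mul_le_mul h3 h4 (by norm_num) (Real.exp_pos _).le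
  norm_num at h5 h1
  linarith

/-- Taking a = 10K gives p ≥ 0.3·exp(-(20K + 3)). The lower bound on K lets the additive constants
be absorbed into a multiple of K. -/
lemma log_one_div_le_of_entropy_bound {K p : ℝ} (hK : 1 / 8000 ≤ K)
    (h : ∀ a s t : ℝ, 0 < a → 0 < s →
      Real.exp (-(a + s * a + t / s)) * (1 / 2 - K / a - Real.exp (-t)) ≤ p) :
    Real.log (1 / p) ≤ 50000 * K := by
  have hK0 : 0 < K := by linarith
  have h1 := h (10 * K) 1 3 (by linarith) one_pos
  have h2 := exp_neg_three_le
  have h3 : K / (10 * K) = 1 / 10 := by field_simp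
  rw [h3] at h1
  have h4 : Real.exp (-(20 * K + 3)) * (3 / 10) ≤ p := by
    refine le_trans ?_ h1
    have : 10 * K + 1 * (10 * K) + 3 / 1 = 20 * K + 3 := by ring
    rw [this]
    gcongr
    linarith
  have h5 : Real.log (Real.exp (-(20 * K + 3)) * (3 / 10)) ≤ Real.log p :=
    Real.log_le_log (by positivity) h4
  rw [Real.log_mul (Real.exp_pos _).ne' (by norm_num), Real.log_exp] at h5
  have h6 : 1 - (3 / 10 : ℝ)⁻¹ ≤ Real.log (3 / 10) := Real.one_sub_inv_le_log_of_pos (by norm_num)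
  rw [one_div, Real.log_inv]
  norm_num at h6
  linarith

variable {dx dy : ℕ}

lemma measurable_frobNorm_sub {alg : Algorithm dx dy} (halg : alg.IsMeasurable) (n : ℕ)
    (B : Matrix (Fin dy) (Fin dx) ℝ) :
    Measurable fun ω : Data dx dy n => frobNorm (alg n ω - B) := by
  refine Real.continuous_sqrt.measurable.comp ?_
  refine Finset.measurable_sum _ fun i _ => Finset.measurable_sum _ fun j _ => ?_
  exact ((halg n i j).sub_const (B i j)).pow_const 2

/-- One estimate cannot be within ε of two parameters more than 2ε apart. -/
lemma disjoint_estimates {n : ℕ} {ε : ℝ} (hε : 0 < ε) (alg : Algorithm dx dy)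
    {B B' : Matrix (Fin dy) (Fin dx) ℝ} (h : 4 * ε ^ 2 < frobSq (B - B')) :
    Disjoint {ω : Data dx dy n | frobNorm (alg n ω - B) ≤ ε}
      {ω : Data dx dy n | frobNorm (alg n ω - B') ≤ ε} := by
  rw [Set.disjoint_left]
  intro ω h1 h2
  simp only [Set.mem_ofPred_eq, frobNorm_eq_sqrt_frobSq] at h1 h2
  rw [Real.sqrt_le_left hε.le] at h1 h2
  have h3 := frobSq_add_le (alg n ω - B') (-(alg n ω - B))
  rw [frobSq_neg, show alg n ω - B' + -(alg n ω - B) = B - B' by abel] at h3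
  linarith

/-- The testing lower bound: an estimator which is accurate at `A` and at each of at least `2 ^ N`
well separated alternatives forces the relative entropy to be large. -/
theorem entropy_lower_bound {P : Model dx dy} {𝒞 : Set (Matrix (Fin dy) (Fin dx) ℝ)} {ε δ K : ℝ}
    {alg : Algorithm dx dy} {n N : ℕ} {A : Matrix (Fin dy) (Fin dx) ℝ}
    [IsProbabilityMeasure (P A n)] (hε : 0 < ε) (hδ2 : δ ≤ 1 / 2) (hN : 2 ≤ N)
    (halg : alg.IsMeasurable) (hstable : StableWith P 𝒞 ε δ alg n) (hA : A ∈ 𝒞)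
    (F : Finset (Matrix (Fin dy) (Fin dx) ℝ)) (hF : ∀ B ∈ F, B ∈ 𝒞) (hcard : 2 ^ N ≤ F.card)
    (hsep : ∀ B ∈ F, ∀ B' ∈ F, B ≠ B' → 4 * ε ^ 2 < frobSq (B - B'))
    (hsepA : ∀ B ∈ F, 4 * ε ^ 2 < frobSq (A - B))
    (hK : ∀ B ∈ F, ChangeOfMeasureBound (P B n) (P A n) K) :
    Real.log (1 / δ) + N ≤ 150000 * K := by
  set E : Matrix (Fin dy) (Fin dx) ℝ → Set (Data dx dy n) :=
    fun B => {ω | frobNorm (alg n ω - B) ≤ ε}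
  have hE : ∀ B, MeasurableSet (E B) := fun B =>
    measurableSet_le (measurable_frobNorm_sub halg n B) measurable_const
  have hsum : ∑ B ∈ F, (P A n).real (E B) ≤ 1 := by
    rw [← measureReal_biUnion_finset _ fun B _ => hE B]
    · exact measureReal_le_one
    · intro B hB B' hB' hne
      exact disjoint_estimates hε alg (hsep B hB B' hB' hne)
  have hpow : (0 : ℝ) < 2 ^ N := by positivity
  have hFne : F.Nonempty := Finset.card_pos.1 (lt_of_lt_of_le (by positivity) hcard)
  -- Pigeonhole. The same `B` serves for both the 2^(-N) and the δ bound.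
  obtain ⟨B, hB, hBN⟩ : ∃ B ∈ F, (P A n).real (E B) ≤ 1 / 2 ^ N := by
    refine Finset.exists_le_of_sum_le hFne (hsum.trans ?_)
    rw [Finset.sum_const, nsmul_eq_mul, mul_one_div, le_div_iff₀ hpow, one_mul]
    exact_mod_cast hcard
  have hBδ : (P A n).real (E B) ≤ δ := by
    have h1 : (P A n).real (E A ∪ E B) = _ :=
      measureReal_union (disjoint_estimates hε alg (hsepA B hB)) (hE B)
    have h2 : (P A n).real (E A ∪ E B) ≤ 1 := measureReal_le_one
    have h3 := hstable A hA
    change 1 - δ ≤ (P A n).real (E A) at h3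
    linarith
  have hBhalf : 1 / 2 ≤ (P B n).real (E B) := by
    have h3 := hstable B (hF B hB)
    change 1 - δ ≤ (P B n).real (E B) at h3
    linarith
  have key : ∀ a s t : ℝ, 0 < a → 0 < s → Real.exp (-(a + s * a + t / s))
      * (1 / 2 - K / a - Real.exp (-t)) ≤ (P A n).real (E B) := by
    intro a s t ha hs
    refine le_trans ?_ (hK B hB (E B) (hE B) a s t ha hs)
    gcongr
  have hquarter : (1 / 2 ^ N : ℝ) ≤ 1 / 4 := by
    refine one_div_le_one_div_of_le (by norm_num) ?_
    calc (4 : ℝ) = 2 ^ 2 := by norm_num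
      _ ≤ 2 ^ N := pow_le_pow_right₀ (by norm_num) hN
  have hK0 := entropy_bound_ge (hBN.trans hquarter) key
  have h1 := log_one_div_le_of_entropy_bound hK0
    fun a s t ha hs => (key a s t ha hs).trans hBδ
  have h2 := log_one_div_le_of_entropy_bound hK0
    fun a s t ha hs => (key a s t ha hs).trans hBN
  rw [one_div_one_div, Real.log_pow] at h2
  have h3 := Real.log_two_gt_d9
  have h4 : (N : ℝ) * (1 / 2) ≤ N * Real.log 2 := by gcongr; linarith
  linarith

end Testing

/-! ### Orthonormal frames and Ky Fan's inequality. -/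

section Frames

variable {m n r : ℕ}

lemma frobSq_mul_transpose_of_isStiefel (M : Matrix (Fin m) (Fin r) ℝ)
    {W : Matrix (Fin n) (Fin r) ℝ} (hW : IsStiefel W) : frobSq (M * Wᵀ) = frobSq M := by
  rw [frobSq_eq_trace, frobSq_eq_trace, Matrix.transpose_mul, Matrix.transpose_transpose,
    Matrix.mul_assoc, Matrix.trace_mul_comm, Matrix.mul_assoc, Matrix.mul_assoc, hW,
    Matrix.mul_one]

lemma frobSq_stiefel_mul {U : Matrix (Fin m) (Fin r) ℝ} (hU : IsStiefel U)
    (M : Matrix (Fin r) (Fin n) ℝ) : frobSq (U * M) = frobSq M := by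
  rw [← frobSq_transpose, Matrix.transpose_mul]
  have := frobSq_mul_transpose_of_isStiefel Mᵀ hU
  rw [this, frobSq_transpose]

lemma frobSq_of_isStiefel {Q : Matrix (Fin m) (Fin r) ℝ} (hQ : IsStiefel Q) : frobSq Q = r := by
  rw [frobSq_eq_trace, hQ, Matrix.trace_one, Fintype.card_fin]

lemma stiefel_mulVec_dotProduct_self {U : Matrix (Fin m) (Fin r) ℝ} (hU : IsStiefel U)
    (x : Fin r → ℝ) : (U *ᵥ x) ⬝ᵥ (U *ᵥ x) = x ⬝ᵥ x := by
  rw [Matrix.dotProduct_mulVec, Matrix.vecMul_mulVec, hU, Matrix.vecMul_one]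

lemma trace_transpose_mul_mul (M : Matrix (Fin m) (Fin m) ℝ) (V : Matrix (Fin m) (Fin r) ℝ) :
    (Vᵀ * M * V).trace = ∑ j, V.col j ⬝ᵥ (M *ᵥ V.col j) := by
  simp only [Matrix.trace, Matrix.diag, Matrix.mul_assoc]
  rfl

lemma transpose_mulVec_dotProduct_self (V : Matrix (Fin m) (Fin r) ℝ) (x : Fin m → ℝ) :
    (Vᵀ *ᵥ x) ⬝ᵥ (Vᵀ *ᵥ x) = ∑ j, (V.col j ⬝ᵥ x) ^ 2 := by
  simp only [dotProduct, Matrix.mulVec, sq]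
  rfl

lemma trace_bottomEigenframe {d : ℕ} {M : Matrix (Fin d) (Fin d) ℝ} {W : Matrix (Fin d) (Fin r) ℝ}
    (hr : 1 ≤ r) (hW : IsBottomEigenframe M W) : (Wᵀ * M * W).trace = r * lambdaLow r M := by
  have hr' : (r : ℝ) ≠ 0 := by positivity
  rw [Matrix.mul_assoc, hW.2, ← Matrix.mul_assoc, hW.1, Matrix.one_mul, Matrix.trace_diagonal,
    lambdaLow, mul_div_cancel₀ _ hr']

/-- BBᵀ is an orthogonal projection, so its diagonal entry p equals the squared norm of its row,
whence p² ≤ p. -/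
lemma row_sq_sum_le_one_of_isStiefel {B : Matrix (Fin m) (Fin r) ℝ} (hB : IsStiefel B)
    (i : Fin m) : ∑ j, B i j ^ 2 ≤ 1 := by
  set p := ∑ j, B i j ^ 2 with hp
  have hidem : B * Bᵀ * (B * Bᵀ) = B * Bᵀ := by
    rw [Matrix.mul_assoc, ← Matrix.mul_assoc Bᵀ, hB, Matrix.one_mul]
  have hii : (B * Bᵀ) i i = p := by simp [Matrix.mul_apply, hp, sq]
  have hsymm : ∀ k, (B * Bᵀ) k i = (B * Bᵀ) i k := by
    intro k; simp [Matrix.mul_apply, mul_comm]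
  have h1 : p = ∑ k, (B * Bᵀ) i k ^ 2 := by
    have := congrFun (congrFun hidem i) i
    rw [hii, Matrix.mul_apply] at this
    rw [← this]
    exact Finset.sum_congr rfl fun k _ => by rw [hsymm, sq]
  have h2 : p ^ 2 ≤ p := by
    conv_rhs => rw [h1]
    rw [← hii]
    exact Finset.single_le_sum (f := fun k => (B * Bᵀ) i k ^ 2) (fun _ _ => sq_nonneg _)
      (Finset.mem_univ i)
  nlinarith

/-- Subtracting the r-th largest value c, which costs rc on both sides, makes the top terms
nonnegative and the others nonpositive; weights in [0, 1] then compare termwise. -/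
lemma sum_mul_le_sum_top {f : ℕ → ℝ} {d : ℕ} (hr : 1 ≤ r) (hrd : r ≤ d)
    (hf : ∀ i j, i ≤ j → j < d → f j ≤ f i) {p : Fin d → ℝ} (hp0 : ∀ i, 0 ≤ p i)
    (hp1 : ∀ i, p i ≤ 1) (hps : ∑ i, p i = r) : ∑ i : Fin d, f i * p i ≤ ∑ j : Fin r, f j := by
  set c := f (r - 1)
  have h1 : ∀ i : Fin d, (f i - c) * p i ≤ if (i : ℕ) < r then f i - c else 0 := by
    intro i
    split_ifs with hi
    · have : c ≤ f i := hf _ _ (by omega) (by omega)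
      exact mul_le_of_le_one_right (by linarith) (hp1 i)
    · have : f i ≤ c := hf _ _ (by omega) i.2
      exact mul_nonpos_of_nonpos_of_nonneg (by linarith) (hp0 i)
  have h2 : ∑ i : Fin d, (if (i : ℕ) < r then f i - c else 0) = ∑ j : Fin r, (f j - c) := by
    rw [Fin.sum_univ_eq_sum_range (fun i => if i < r then f i - c else 0) d,
      Fin.sum_univ_eq_sum_range (fun i => f i - c) r, ← Finset.sum_filter]
    congr 1
    ext i
    simp only [Finset.mem_filter, Finset.mem_range]
    omega
  have h3 := Finset.sum_le_sum fun i (_ : i ∈ Finset.univ) => h1 i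
  rw [h2, Finset.sum_sub_distrib] at h3
  simp only [sub_mul, Finset.sum_sub_distrib, ← Finset.mul_sum, hps, Finset.sum_const,
    Finset.card_univ, Fintype.card_fin, nsmul_eq_mul] at h3
  linarith

/-- Ky Fan's inequality: a compression to an `r`-dimensional subspace has trace at most the sum of
the `r` largest eigenvalues. -/
theorem trace_compression_le {d : ℕ} {M : Matrix (Fin d) (Fin d) ℝ} (hM : M.IsHermitian)
    {R : Matrix (Fin d) (Fin r) ℝ} (hr : 1 ≤ r) (hrd : r ≤ d) (hR : IsStiefel R) :
    (Rᵀ * M * R).trace ≤ r * lambdaHigh r M := by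
  classical
  have hr' : (r : ℝ) ≠ 0 := by positivity
  rw [lambdaHigh, mul_div_cancel₀ _ hr']
  set U : Matrix (Fin d) (Fin d) ℝ := hM.eigenvectorUnitary.1
  have hUU : U * Uᵀ = 1 := by
    have := Unitary.mul_star_self_of_mem hM.eigenvectorUnitary.2
    rwa [Matrix.star_eq_conjTranspose, Matrix.conjTranspose_eq_transpose_of_trivial] at this
  have hspec : M = U * Matrix.diagonal hM.eigenvalues * Uᵀ := by
    conv_lhs => rw [hM.spectral_theorem]
    rw [Unitary.conjStarAlgAut_apply, Matrix.star_eq_conjTranspose,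
      Matrix.conjTranspose_eq_transpose_of_trivial]
    rfl
  set B := Uᵀ * R with hBdef
  have hB : IsStiefel B := by
    unfold IsStiefel
    rw [hBdef, Matrix.transpose_mul, Matrix.transpose_transpose, Matrix.mul_assoc,
      ← Matrix.mul_assoc U, hUU, Matrix.one_mul]
    exact hR
  have htr : (Rᵀ * M * R).trace = ∑ i, hM.eigenvalues i * ∑ j, B i j ^ 2 := by
    have h1 : Rᵀ * M * R = Bᵀ * (Matrix.diagonal hM.eigenvalues * B) := by
      conv_lhs => rw [hspec]
      rw [hBdef, Matrix.transpose_mul, Matrix.transpose_transpose]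
      simp only [Matrix.mul_assoc]
    rw [h1]
    simp only [Matrix.trace, Matrix.diag, Matrix.mul_apply (M := Bᵀ), Matrix.diagonal_mul,
      Matrix.transpose_apply, Finset.mul_sum]
    rw [Finset.sum_comm]
    exact Finset.sum_congr rfl fun i _ => Finset.sum_congr rfl fun j _ => by ring
  have hcard : Fintype.card (Fin d) = d := Fintype.card_fin d
  -- The reindexing from decreasing order to the order of `eigenvalues`.
  let e : Fin d ≃ Fin d := (finCongr hcard).symm.trans
    (Fintype.equivOfCardEq (Fintype.card_fin (Fintype.card (Fin d))))
  have heig : ∀ i : Fin d, hM.eigenvalues (e i) = eig M i := by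
    intro i
    rw [eig, dif_pos hM, dif_pos (by rw [hcard]; exact i.2)]
    simp only [Matrix.IsHermitian.eigenvalues, e, Equiv.trans_apply]
    rw [Equiv.symm_apply_apply]
    rfl
  rw [htr, ← Equiv.sum_comp e]
  simp only [heig]
  refine sum_mul_le_sum_top hr hrd (f := eig M) ?_
    (fun i => Finset.sum_nonneg fun _ _ => sq_nonneg _)
    (fun i => row_sq_sum_le_one_of_isStiefel hB _) ?_
  · intro i j hij hj
    have hi : i < Fintype.card (Fin d) := by rw [hcard]; omega
    have hj' : j < Fintype.card (Fin d) := by rw [hcard]; omega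
    rw [eig, eig, dif_pos hM, dif_pos hM, dif_pos hi, dif_pos hj']
    exact hM.eigenvalues₀_antitone hij
  · rw [Equiv.sum_comp e fun i => ∑ j, B i j ^ 2]
    exact frobSq_of_isStiefel hB

end Frames

/-! ### The Gramian, the Lyapunov equation and its stability under perturbation. -/

section Gramian

variable {d : ℕ} {A : Matrix (Fin d) (Fin d) ℝ}

section PowerBound

attribute [local instance] Matrix.linftyOpNormedRing Matrix.linftyOpNormedAlgebra

/-- Gelfand's formula, with ρ strictly between the spectral radius and 1. -/
lemma exists_pow_entry_bound (hA : IsSchurStable A) :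
    ∃ ρ : ℝ, 0 ≤ ρ ∧ ρ < 1 ∧ ∀ᶠ t : ℕ in Filter.atTop, ∀ i j, |(A ^ t) i j| ≤ ρ ^ t := by
  set B : Matrix (Fin d) (Fin d) ℂ := A.map (algebraMap ℝ ℂ) with hB
  obtain ⟨ρ, hρ0, hρ1⟩ := ENNReal.lt_iff_exists_nnreal_btwn.1 (show spectralRadius ℂ B < 1 from hA)
  refine ⟨ρ, ρ.2, by exact_mod_cast hρ1, ?_⟩
  have hlim := spectrum.pow_nnnorm_pow_one_div_tendsto_nhds_spectralRadius B
  filter_upwards [hlim.eventually_lt_const hρ0, Filter.eventually_gt_atTop 0] with t ht ht0 i j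
  have ht0' : (0 : ℝ) < t := by exact_mod_cast ht0
  have h1 : ‖B ^ t‖₊ ≤ ρ ^ t := by
    have h2 := ENNReal.rpow_le_rpow ht.le ht0'.le
    rw [← ENNReal.rpow_mul, one_div_mul_cancel ht0'.ne', ENNReal.rpow_one,
      ENNReal.rpow_natCast] at h2
    exact_mod_cast h2
  have h3 : ‖(B ^ t) i j‖₊ ≤ ‖B ^ t‖₊ := by
    rw [Matrix.linfty_opNNNorm_def]
    refine le_trans ?_ (Finset.le_sup (f := fun i => ∑ j, ‖(B ^ t) i j‖₊) (Finset.mem_univ i))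
    exact Finset.single_le_sum (f := fun j => ‖(B ^ t) i j‖₊) (fun _ _ => zero_le)
      (Finset.mem_univ j)
  have h4 : (B ^ t) i j = (((A ^ t) i j : ℝ) : ℂ) := by
    have : B ^ t = (A ^ t).map (algebraMap ℝ ℂ) := by
      have := map_pow (RingHom.mapMatrix (m := Fin d) (algebraMap ℝ ℂ)) A t
      exact this.symm
    rw [this]; rfl
  have h5 : ‖(B ^ t) i j‖ ≤ (ρ : ℝ) ^ t := by exact_mod_cast h3.trans h1
  rw [h4, Complex.norm_real] at h5
  exact h5

end PowerBound

lemma summable_gramian (hA : IsSchurStable A) : Summable fun t : ℕ => A ^ t * (A ^ t)ᵀ := by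
  obtain ⟨ρ, hρ0, hρ1, hev⟩ := exists_pow_entry_bound hA
  have hg : Summable fun t : ℕ => (d : ℝ) * (ρ ^ 2) ^ t :=
    (summable_geometric_of_lt_one (sq_nonneg ρ) (by nlinarith)).mul_left _
  refine Pi.summable.2 fun i => Pi.summable.2 fun j => ?_
  refine Summable.of_norm_bounded_eventually_nat hg ?_
  filter_upwards [hev] with t ht
  rw [Matrix.mul_apply]
  refine (norm_sum_le _ _).trans ?_
  refine (Finset.sum_le_card_nsmul _ _ ((ρ ^ 2) ^ t) fun k _ => ?_).trans ?_
  · rw [norm_mul, ← pow_mul, mul_comm 2 t, pow_mul, sq]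
    exact mul_le_mul (ht i k) (ht j k) (norm_nonneg _) (by positivity)
  · simp

lemma gramian_isHermitian : (gramian A).IsHermitian := by
  rw [Matrix.IsHermitian, Matrix.conjTranspose_eq_transpose_of_trivial, gramian,
    Matrix.transpose_tsum]
  simp [Matrix.transpose_mul]

lemma hasSum_gramian_quadForm (hA : IsSchurStable A) (v : Fin d → ℝ) :
    HasSum (fun t : ℕ => ((A ^ t)ᵀ *ᵥ v) ⬝ᵥ ((A ^ t)ᵀ *ᵥ v)) (v ⬝ᵥ (gramian A *ᵥ v)) := by
  let φ : Matrix (Fin d) (Fin d) ℝ →+ ℝ :=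
    { toFun := fun M => v ⬝ᵥ (M *ᵥ v)
      map_zero' := by simp
      map_add' := fun M N => by rw [Matrix.add_mulVec, dotProduct_add] }
  have hφ : Continuous φ := by
    change Continuous fun M : Matrix (Fin d) (Fin d) ℝ => v ⬝ᵥ (M *ᵥ v)
    fun_prop
  have h := (summable_gramian hA).hasSum.map φ hφ
  have e : (fun t : ℕ => ((A ^ t)ᵀ *ᵥ v) ⬝ᵥ ((A ^ t)ᵀ *ᵥ v))
      = fun t => φ (A ^ t * (A ^ t)ᵀ) := by
    funext t
    change _ = v ⬝ᵥ ((A ^ t * (A ^ t)ᵀ) *ᵥ v)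
    rw [← Matrix.mulVec_mulVec, Matrix.dotProduct_mulVec v, ← Matrix.mulVec_transpose]
  rw [e]
  exact h

lemma gramian_quadForm_nonneg (hA : IsSchurStable A) (v : Fin d → ℝ) :
    0 ≤ v ⬝ᵥ (gramian A *ᵥ v) :=
  (hasSum_gramian_quadForm hA v).nonneg fun _ => Finset.sum_nonneg fun _ _ => mul_self_nonneg _

/-- The discrete Lyapunov equation, as an identity of quadratic forms. -/
lemma gramian_lyapunov (hA : IsSchurStable A) (v : Fin d → ℝ) :
    v ⬝ᵥ (gramian A *ᵥ v) = v ⬝ᵥ v + (Aᵀ *ᵥ v) ⬝ᵥ (gramian A *ᵥ (Aᵀ *ᵥ v)) := by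
  have h1 := hasSum_gramian_quadForm hA v
  have h2 := hasSum_gramian_quadForm hA (Aᵀ *ᵥ v)
  have h3 := h1.tsum_eq
  rw [h1.summable.tsum_eq_zero_add] at h3
  rw [← h3, ← h2.tsum_eq]
  congr 1
  · simp
  · refine tsum_congr fun t => ?_
    rw [pow_succ', Matrix.transpose_mul, Matrix.mulVec_mulVec]

lemma quadForm_le_opNorm (M : Matrix (Fin d) (Fin d) ℝ) (v : Fin d → ℝ) :
    v ⬝ᵥ (M *ᵥ v) ≤ opNorm M * (v ⬝ᵥ v) := by
  set x : EuclideanSpace ℝ (Fin d) := WithLp.toLp 2 v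
  have h1 : inner ℝ x (Matrix.toEuclideanCLM (n := Fin d) (𝕜 := ℝ) M x) = v ⬝ᵥ (M *ᵥ v) := by
    rw [Matrix.toEuclideanCLM_toLp, EuclideanSpace.inner_toLp_toLp, star_trivial, dotProduct_comm]
  have h2 : ‖x‖ * ‖x‖ = v ⬝ᵥ v := by
    rw [← real_inner_self_eq_norm_mul_norm, EuclideanSpace.inner_toLp_toLp, star_trivial]
  rw [← h1, ← h2]
  calc _ ≤ ‖x‖ * ‖Matrix.toEuclideanCLM (n := Fin d) (𝕜 := ℝ) M x‖ := real_inner_le_norm _ _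
    _ ≤ ‖x‖ * (opNorm M * ‖x‖) := by gcongr; exact ContinuousLinearMap.le_opNorm _ _
    _ = _ := by ring

lemma one_le_opNorm_gramian (hd : 1 ≤ d) (hA : IsSchurStable A) : 1 ≤ opNorm (gramian A) := by
  set v : Fin d → ℝ := Pi.single ⟨0, hd⟩ 1
  have hv : v ⬝ᵥ v = 1 := by simp [v]
  have h1 := quadForm_le_opNorm (gramian A) v
  have h2 := gramian_lyapunov hA v
  have h3 := gramian_quadForm_nonneg hA (Aᵀ *ᵥ v)
  rw [hv] at h1 h2
  linarith

/-- Under a small perturbation `D` of `A`, four times the Gramian of `A` still dominates the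
Lyapunov recursion. -/
lemma gramian_lyapunov_perturbed (hd : 1 ≤ d) (hA : IsSchurStable A)
    {D : Matrix (Fin d) (Fin d) ℝ} {s : ℝ} (hs0 : 0 ≤ s)
    (hs : s ≤ 1 / (4 * opNorm (gramian A) ^ 3))
    (hD : ∀ v, (Dᵀ *ᵥ v) ⬝ᵥ (Dᵀ *ᵥ v) ≤ s ^ 2 * (v ⬝ᵥ v)) (v : Fin d → ℝ) :
    v ⬝ᵥ v + ((A + D)ᵀ *ᵥ v) ⬝ᵥ (((4 : ℝ) • gramian A) *ᵥ ((A + D)ᵀ *ᵥ v))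
      ≤ v ⬝ᵥ (((4 : ℝ) • gramian A) *ᵥ v) := by
  set G := gramian A with hG
  set g := opNorm G with hg
  have hg1 : 1 ≤ g := one_le_opNorm_gramian hd hA
  have hg0 : 0 < g := by linarith
  set x := Aᵀ *ᵥ v with hx
  set y := Dᵀ *ᵥ v with hy
  have hsymm : x ⬝ᵥ (G *ᵥ y) = y ⬝ᵥ (G *ᵥ x) := by
    have : Gᵀ = G := by
      have := gramian_isHermitian (A := A)
      rwa [Matrix.IsHermitian, Matrix.conjTranspose_eq_transpose_of_trivial] at this
    rw [Matrix.dotProduct_mulVec, ← Matrix.mulVec_transpose, this, dotProduct_comm]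
  have hexp : ∀ c : ℝ, (x + c • y) ⬝ᵥ (G *ᵥ (x + c • y))
      = x ⬝ᵥ (G *ᵥ x) + 2 * c * (y ⬝ᵥ (G *ᵥ x)) + c ^ 2 * (y ⬝ᵥ (G *ᵥ y)) := by
    intro c
    simp only [Matrix.mulVec_add, Matrix.mulVec_smul, add_dotProduct, dotProduct_add,
      smul_dotProduct, dotProduct_smul, smul_eq_mul, hsymm]
    ring
  have hlyap := gramian_lyapunov hA v
  have hqx : x ⬝ᵥ (G *ᵥ x) ≤ g * (v ⬝ᵥ v) := by
    have := quadForm_le_opNorm G v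
    have hvv : 0 ≤ v ⬝ᵥ v := Finset.sum_nonneg fun _ _ => mul_self_nonneg _
    linarith
  have hqy : y ⬝ᵥ (G *ᵥ y) ≤ g * (s ^ 2 * (v ⬝ᵥ v)) :=
    (quadForm_le_opNorm G y).trans (by gcongr; exact hD v)
  -- Young's inequality for the cross term, in the form of positivity at x - 2g y. The weight 2g
  -- charges xᵀGx ≤ g|v|² only |v|²/2.
  have hpos := gramian_quadForm_nonneg hA (x + (-(2 * g)) • y)
  rw [hexp] at hpos
  have h1 := hexp 1
  rw [one_smul] at h1
  have hvv : 0 ≤ v ⬝ᵥ v := Finset.sum_nonneg fun _ _ => mul_self_nonneg _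
  have hqy0 : 0 ≤ y ⬝ᵥ (G *ᵥ y) := gramian_quadForm_nonneg hA y
  rw [Matrix.transpose_add, Matrix.add_mulVec, Matrix.smul_mulVec, Matrix.smul_mulVec,
    dotProduct_smul, dotProduct_smul, smul_eq_mul, smul_eq_mul, h1, hlyap]
  have hsg : s ^ 2 * g ^ 2 ≤ 1 / 16 := by
    rw [le_div_iff₀ (by positivity)] at hs
    have hg3 : g ≤ g ^ 3 := le_self_pow₀ hg1 (by norm_num)
    have : s * g ≤ 1 / 4 := by nlinarith
    have h0 : 0 ≤ s * g := by positivity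
    nlinarith
  have hcross : 2 * (y ⬝ᵥ (G *ᵥ x)) ≤ 1 / 2 * (v ⬝ᵥ v) + 2 * g * (y ⬝ᵥ (G *ᵥ y)) := by
    have h2 : 2 * g * (2 * (y ⬝ᵥ (G *ᵥ x)))
        ≤ 2 * g * (1 / 2 * (v ⬝ᵥ v) + 2 * g * (y ⬝ᵥ (G *ᵥ y))) := by linarith
    exact le_of_mul_le_mul_left h2 (by positivity)
  have hgy : g * (y ⬝ᵥ (G *ᵥ y)) ≤ 1 / 16 * (v ⬝ᵥ v) := by
    calc _ ≤ g * (g * (s ^ 2 * (v ⬝ᵥ v))) := by gcongr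
      _ = s ^ 2 * g ^ 2 * (v ⬝ᵥ v) := by ring
      _ ≤ _ := by gcongr
  have hyy : y ⬝ᵥ (G *ᵥ y) ≤ 1 / 16 * (v ⬝ᵥ v) :=
    (le_mul_of_one_le_left hqy0 hg1).trans hgy
  -- The perturbation adds at most (1/2 + 1/8 + 1/16)|v|² = (11/16)|v|² to the quadratic form; four
  -- times this plus |v|² is below the 4|v|² supplied by the Lyapunov equation.
  linarith

end Gramian

/-! ### Size of low-rank perturbations. -/

section LowRankPerturbation

variable {m n r : ℕ}

lemma lowRank_mulVec_dotProduct_self {Q : Matrix (Fin m) (Fin r) ℝ} (hQ : IsStiefel Q)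
    (V : Matrix (Fin n) (Fin r) ℝ) (s : ℝ) (x : Fin n → ℝ) :
    ((s • (Q * Vᵀ)) *ᵥ x) ⬝ᵥ ((s • (Q * Vᵀ)) *ᵥ x) = s ^ 2 * ((Vᵀ *ᵥ x) ⬝ᵥ (Vᵀ *ᵥ x)) := by
  rw [Matrix.smul_mulVec, ← Matrix.mulVec_mulVec, smul_dotProduct, dotProduct_smul,
    stiefel_mulVec_dotProduct_self hQ, smul_eq_mul, smul_eq_mul]
  ring

lemma stiefel_transpose_mulVec_le {Q : Matrix (Fin m) (Fin r) ℝ} (hQ : IsStiefel Q)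
    (x : Fin m → ℝ) : (Qᵀ *ᵥ x) ⬝ᵥ (Qᵀ *ᵥ x) ≤ x ⬝ᵥ x := by
  set y := Qᵀ *ᵥ x with hy
  have h1 : (Q *ᵥ y) ⬝ᵥ x = y ⬝ᵥ y := by
    rw [dotProduct_comm, Matrix.dotProduct_mulVec, ← Matrix.mulVec_transpose]
  have h2 : 0 ≤ (x - Q *ᵥ y) ⬝ᵥ (x - Q *ᵥ y) :=
    Finset.sum_nonneg fun _ _ => mul_self_nonneg _
  rw [sub_dotProduct, dotProduct_sub, dotProduct_sub, stiefel_mulVec_dotProduct_self hQ,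
    dotProduct_comm x (Q *ᵥ y), h1] at h2
  linarith

lemma lowRank_transpose_mulVec_le {Q : Matrix (Fin m) (Fin r) ℝ} (hQ : IsStiefel Q)
    {V : Matrix (Fin n) (Fin r) ℝ} (hV : IsStiefel V) (s : ℝ) (x : Fin m → ℝ) :
    ((s • (Q * Vᵀ))ᵀ *ᵥ x) ⬝ᵥ ((s • (Q * Vᵀ))ᵀ *ᵥ x) ≤ s ^ 2 * (x ⬝ᵥ x) := by
  rw [Matrix.transpose_smul, Matrix.transpose_mul, Matrix.transpose_transpose,
    lowRank_mulVec_dotProduct_self hV]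
  gcongr
  exact stiefel_transpose_mulVec_le hQ x

lemma lintegral_ofReal_sum {Ω ι : Type*} [MeasurableSpace Ω] [Fintype ι] (P : Measure Ω)
    {f : ι → Ω → ℝ} (hf : ∀ i, Measurable (f i)) (h0 : ∀ i ω, 0 ≤ f i ω) :
    ∫⁻ ω, ENNReal.ofReal (∑ i, f i ω) ∂P = ∑ i, ∫⁻ ω, ENNReal.ofReal (f i ω) ∂P := by
  rw [← lintegral_finsetSum _ fun i _ => (hf i).ennreal_ofReal]
  exact lintegral_congr fun ω => ENNReal.ofReal_sum_of_nonneg fun i _ => h0 i ω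

end LowRankPerturbation

/-! ### Relative entropy in multivariate regression. -/

section Regression

variable {dx dy r : ℕ} {μ : Measure (Fin dx → ℝ)} {σ : ℝ}

lemma lintegral_frame_sq (hμ : ∀ i, MemLp (fun x : Fin dx → ℝ => x i) 2 μ)
    (V : Matrix (Fin dx) (Fin r) ℝ) :
    ∫⁻ x, ENNReal.ofReal ((Vᵀ *ᵥ x) ⬝ᵥ (Vᵀ *ᵥ x)) ∂μ
      = ENNReal.ofReal (Vᵀ * secondMoment μ * V).trace := by
  have hint : ∀ a b, Integrable (fun x : Fin dx → ℝ => x a * x b) μ :=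
    fun a b => (hμ a).integrable_mul (hμ b)
  have hexp : ∀ x : Fin dx → ℝ, (Vᵀ *ᵥ x) ⬝ᵥ (Vᵀ *ᵥ x)
      = ∑ j, ∑ a, ∑ b, V a j * V b j * (x a * x b) := by
    intro x
    rw [transpose_mulVec_dotProduct_self]
    refine Finset.sum_congr rfl fun j _ => ?_
    rw [sq, dotProduct, Finset.sum_mul_sum]
    refine Finset.sum_congr rfl fun a _ => Finset.sum_congr rfl fun b _ => ?_
    simp only [Matrix.col_apply]
    ring
  have hI : Integrable (fun x : Fin dx → ℝ => (Vᵀ *ᵥ x) ⬝ᵥ (Vᵀ *ᵥ x)) μ := by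
    simp only [hexp]
    exact integrable_finsetSum _ fun j _ => integrable_finsetSum _ fun a _ =>
      integrable_finsetSum _ fun b _ => (hint a b).const_mul _
  rw [← ofReal_integral_eq_lintegral_ofReal hI
    (Filter.Eventually.of_forall fun x => Finset.sum_nonneg fun _ _ => mul_self_nonneg _)]
  congr 1
  simp only [hexp]
  rw [integral_finsetSum _ fun j _ => integrable_finsetSum _ fun a _ =>
      integrable_finsetSum _ fun b _ => (hint a b).const_mul _, trace_transpose_mul_mul]
  refine Finset.sum_congr rfl fun j _ => ?_
  rw [integral_finsetSum _ fun a _ =>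
      integrable_finsetSum _ fun b _ => (hint a b).const_mul _, dotProduct]
  refine Finset.sum_congr rfl fun a _ => ?_
  rw [integral_finsetSum _ fun b _ => (hint a b).const_mul _, Matrix.mulVec, dotProduct,
    Finset.mul_sum]
  refine Finset.sum_congr rfl fun b _ => ?_
  rw [integral_const_mul]
  simp only [Matrix.col_apply, secondMoment, Matrix.of_apply]
  ring

variable [IsProbabilityMeasure μ]

/-- One regression data set as a function of the covariates and the noise. -/
def regressionData (A : Matrix (Fin dy) (Fin dx) ℝ) {n : ℕ}
    (e : Fin n → (Fin dx → ℝ) × (Fin dy → ℝ)) : Data dx dy n :=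
  fun i => ((e i).1, A *ᵥ (e i).1 + (e i).2)

lemma measurable_regressionObservation (A : Matrix (Fin dy) (Fin dx) ℝ) :
    Measurable fun p : (Fin dx → ℝ) × (Fin dy → ℝ) => (p.1, A *ᵥ p.1 + p.2) := by
  have : Measurable fun p : (Fin dx → ℝ) × (Fin dy → ℝ) => A *ᵥ p.1 :=
    (Continuous.matrix_mulVec continuous_const continuous_fst).measurable
  fun_prop

lemma measurable_regressionData (A : Matrix (Fin dy) (Fin dx) ℝ) (n : ℕ) :
    Measurable (regressionData A (n := n)) :=
  measurable_pi_lambda _ fun i =>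
    (measurable_regressionObservation A).comp (measurable_pi_apply i)

lemma regressionModel_eq_map (A : Matrix (Fin dy) (Fin dx) ℝ) (n : ℕ) :
    regressionModel μ σ A n
      = (Measure.pi fun _ : Fin n => μ.prod (gaussianNoise σ dy)).map (regressionData A) := by
  have hm := measurable_regressionObservation A
  have : IsProbabilityMeasure ((μ.prod (gaussianNoise σ dy)).map
      fun p => (p.1, A *ᵥ p.1 + p.2)) := Measure.isProbabilityMeasure_map hm.aemeasurable
  rw [regressionModel, ← Measure.pi_map_pi fun _ => hm.aemeasurable]
  rfl

lemma isProbabilityMeasure_regressionModel (A : Matrix (Fin dy) (Fin dx) ℝ) (n : ℕ) :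
    IsProbabilityMeasure (regressionModel μ σ A n) := by
  rw [regressionModel_eq_map]
  exact Measure.isProbabilityMeasure_map (measurable_regressionData A n).aemeasurable

theorem regression_changeOfMeasureBound (hσ : 0 < σ)
    (hμ : ∀ i, MemLp (fun x : Fin dx → ℝ => x i) 2 μ) (A : Matrix (Fin dy) (Fin dx) ℝ)
    {Q : Matrix (Fin dy) (Fin r) ℝ} (hQ : IsStiefel Q) (V : Matrix (Fin dx) (Fin r) ℝ) (s : ℝ)
    (n : ℕ) {T : ℝ} (hT : (Vᵀ * secondMoment μ * V).trace ≤ T) (hT0 : 0 ≤ T) :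
    ChangeOfMeasureBound (regressionModel μ σ (A + s • (Q * Vᵀ)) n) (regressionModel μ σ A n)
      (n * (s ^ 2 * T / (2 * σ ^ 2))) := by
  set D := s • (Q * Vᵀ) with hD
  -- The covariate is the exogenous variable, and replacing η by η + Dx turns the response of `A`
  -- into that of `A + D`.
  let h : PredictableShift (Fin dx → ℝ) dy := fun _ _ z => D *ᵥ z
  have hcont : Continuous fun z : Fin dx → ℝ => D *ᵥ z :=
    Continuous.matrix_mulVec continuous_const continuous_id
  have hh : h.IsMeasurable := fun t => hcont.measurable.comp measurable_snd
  rw [regressionModel_eq_map, regressionModel_eq_map]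
  refine changeOfMeasureBound_map hσ μ hh (measurable_regressionData A n) ?_ (by positivity) ?_
  · intro e
    funext i
    simp only [regressionData, PredictableShift.map, PredictableShift.value, h, Matrix.add_mulVec]
    congr 1
    abel
  · have hquad : ∀ e : Fin n → (Fin dx → ℝ) × (Fin dy → ℝ), h.quad e / (2 * σ ^ 2)
        = ∑ i, s ^ 2 / (2 * σ ^ 2) * ((Vᵀ *ᵥ (e i).1) ⬝ᵥ (Vᵀ *ᵥ (e i).1)) := by
      intro e
      rw [PredictableShift.quad, Finset.sum_div]
      refine Finset.sum_congr rfl fun i _ => ?_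
      change (D *ᵥ (e i).1) ⬝ᵥ (D *ᵥ (e i).1) / _ = _
      rw [hD, lowRank_mulVec_dotProduct_self hQ]
      ring
    have hVm : Measurable fun z : Fin dx → ℝ => (Vᵀ *ᵥ z) ⬝ᵥ (Vᵀ *ᵥ z) := by
      have : Continuous fun z : Fin dx → ℝ => Vᵀ *ᵥ z :=
        Continuous.matrix_mulVec continuous_const continuous_id
      exact (this.dotProduct this).measurable
    simp only [hquad]
    rw [lintegral_ofReal_sum]
    · have hone : ∀ i : Fin n, ∫⁻ e, ENNReal.ofReal (s ^ 2 / (2 * σ ^ 2)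
          * ((Vᵀ *ᵥ (e i).1) ⬝ᵥ (Vᵀ *ᵥ (e i).1)))
          ∂Measure.pi (fun _ : Fin n => μ.prod (gaussianNoise σ dy))
          ≤ ENNReal.ofReal (s ^ 2 * T / (2 * σ ^ 2)) := by
        intro i
        have hc : 0 ≤ s ^ 2 / (2 * σ ^ 2) := by positivity
        have hmp : MeasurePreserving (fun e : Fin n → (Fin dx → ℝ) × (Fin dy → ℝ) => (e i).1)
            (Measure.pi (fun _ : Fin n => μ.prod (gaussianNoise σ dy))) μ :=
          measurePreserving_fst.comp (measurePreserving_eval _ i)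
        rw [hmp.lintegral_comp (f := fun z => ENNReal.ofReal (s ^ 2 / (2 * σ ^ 2)
          * ((Vᵀ *ᵥ z) ⬝ᵥ (Vᵀ *ᵥ z)))) (by fun_prop)]
        simp only [ENNReal.ofReal_mul hc]
        rw [lintegral_const_mul _ (by fun_prop), lintegral_frame_sq hμ, ← ENNReal.ofReal_mul hc]
        refine ENNReal.ofReal_le_ofReal ?_
        rw [mul_div_right_comm]
        gcongr
      refine (Finset.sum_le_sum fun i _ => hone i).trans ?_
      rw [Finset.sum_const, Finset.card_univ, Fintype.card_fin, ENNReal.ofReal_mul (by positivity),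
        nsmul_eq_mul, ENNReal.ofReal_natCast]
    · intro i
      have : Measurable fun e : Fin n → (Fin dx → ℝ) × (Fin dy → ℝ) => (e i).1 := by fun_prop
      exact (hVm.comp this).const_mul _
    · intro i e
      have : 0 ≤ (Vᵀ *ᵥ (e i).1) ⬝ᵥ (Vᵀ *ᵥ (e i).1) :=
        Finset.sum_nonneg fun _ _ => mul_self_nonneg _
      positivity

end Regression

/-! ### Second moments of linear functionals of the noise. -/

section SecondMoments

/-- `f` is square integrable and centered with second moment `c`. -/
def HasCenteredMoment {Ω : Type*} [MeasurableSpace Ω] (f : Ω → ℝ) (P : Measure Ω) (c : ℝ) : Prop :=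
  MemLp f 2 P ∧ ∫ ω, f ω ∂P = 0 ∧ ∫ ω, f ω ^ 2 ∂P = c

lemma HasCenteredMoment.comp {Ω Ω' : Type*} [MeasurableSpace Ω] [MeasurableSpace Ω']
    {P : Measure Ω} {P' : Measure Ω'} {f : Ω' → ℝ} {c : ℝ} (hf : HasCenteredMoment f P' c)
    {g : Ω → Ω'} (hg : MeasurePreserving g P P') : HasCenteredMoment (fun ω => f (g ω)) P c := by
  have haf := hf.1.aestronglyMeasurable
  rw [← hg.map_eq] at haf
  refine ⟨hf.1.comp_measurePreserving hg, ?_, ?_⟩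
  · rw [← integral_map hg.measurable.aemeasurable haf, hg.map_eq]
    exact hf.2.1
  · rw [← integral_map hg.measurable.aemeasurable (f := fun y => f y ^ 2) (haf.pow 2), hg.map_eq]
    exact hf.2.2

lemma HasCenteredMoment.pi_sum {ι : Type*} [Fintype ι] {Ω : ι → Type*}
    [∀ i, MeasurableSpace (Ω i)] {P : ∀ i, Measure (Ω i)} [∀ i, IsProbabilityMeasure (P i)]
    {f : ∀ i, Ω i → ℝ} {c : ι → ℝ} (hf : ∀ i, HasCenteredMoment (f i) (P i) (c i)) :
    HasCenteredMoment (fun ω => ∑ i, f i (ω i)) (Measure.pi P) (∑ i, c i) := by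
  have heval : ∀ i, HasCenteredMoment (fun ω : ∀ i, Ω i => f i (ω i)) (Measure.pi P) (c i) :=
    fun i => (hf i).comp (measurePreserving_eval _ i)
  have hL : MemLp (fun ω : ∀ i, Ω i => ∑ i, f i (ω i)) 2 (Measure.pi P) :=
    memLp_finsetSum _ fun i _ => (heval i).1
  have h0 : ∫ ω, ∑ i, f i (ω i) ∂Measure.pi P = 0 := by
    rw [integral_finsetSum _ fun i _ => (heval i).1.integrable (by norm_num)]
    exact Finset.sum_eq_zero fun i _ => (heval i).2.1
  refine ⟨hL, h0, ?_⟩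
  rw [← variance_of_integral_eq_zero hL.aestronglyMeasurable.aemeasurable h0]
  have hv := variance_sum_pi (μ := P) (X := f) fun i => (hf i).1
  have e : (∑ i, fun ω : ∀ i, Ω i => f i (ω i)) = fun ω => ∑ i, f i (ω i) := by
    funext ω; simp
  rw [e] at hv
  rw [hv]
  refine Finset.sum_congr rfl fun i _ => ?_
  rw [variance_of_integral_eq_zero (hf i).1.aestronglyMeasurable.aemeasurable (hf i).2.1]
  exact (hf i).2.2

lemma hasCenteredMoment_gaussianReal (v : NNReal) (a : ℝ) :
    HasCenteredMoment (fun x => a * x) (gaussianReal 0 v) (v * (a * a)) := by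
  have h1 : MemLp (fun x : ℝ => x) 2 (gaussianReal 0 v) := memLp_id_gaussianReal 2
  have h0 : ∫ x, x ∂gaussianReal 0 v = 0 := integral_id_gaussianReal
  refine ⟨h1.const_mul a, ?_, ?_⟩
  · rw [integral_const_mul, h0, mul_zero]
  · have h2 : ∫ x, x ^ 2 ∂gaussianReal 0 v = v := by
      rw [← variance_of_integral_eq_zero (X := fun x : ℝ => x) measurable_id.aemeasurable h0]
      exact variance_fun_id_gaussianReal
    simp only [mul_pow]
    rw [integral_const_mul, h2]
    ring

lemma hasCenteredMoment_noise_sum {Z : Type*} [MeasurableSpace Z] (μ : Measure Z)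
    [IsProbabilityMeasure μ] (σ : ℝ) {d n : ℕ} (w : Fin n → Fin d → ℝ) :
    HasCenteredMoment (fun e : Fin n → Z × (Fin d → ℝ) => ∑ i, w i ⬝ᵥ (e i).2)
      (Measure.pi fun _ => μ.prod (gaussianNoise σ d)) (σ ^ 2 * ∑ i, w i ⬝ᵥ w i) := by
  rw [Finset.mul_sum]
  refine HasCenteredMoment.pi_sum (f := fun i (x : Z × (Fin d → ℝ)) => w i ⬝ᵥ x.2) fun i => ?_
  refine HasCenteredMoment.comp (f := fun y => w i ⬝ᵥ y) ?_ measurePreserving_snd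
  simp only [dotProduct, Finset.mul_sum]
  refine HasCenteredMoment.pi_sum (f := fun j (x : ℝ) => w i j * x) fun j => ?_
  have := hasCenteredMoment_gaussianReal (Real.toNNReal (σ ^ 2)) (w i j)
  rwa [Real.coe_toNNReal _ (sq_nonneg σ)] at this

end SecondMoments

/-! ### Relative entropy in linear system identification. -/

section System

variable {d r n : ℕ} {σ : ℝ}

/-- A finite noise sequence continued by zero. -/
def noiseOf {n : ℕ} (e : Fin n → Unit × (Fin d → ℝ)) (t : ℕ) : Fin d → ℝ :=
  if h : t < n then (e ⟨t, h⟩).2 else 0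

lemma trajectory_congr (A : Matrix (Fin d) (Fin d) ℝ) {η η' : ℕ → Fin d → ℝ} {t : ℕ}
    (h : ∀ s < t, η s = η' s) : trajectory A η t = trajectory A η' t := by
  induction t with
  | zero => rfl
  | succ t ih =>
    rw [trajectory, trajectory, ih fun s hs => h s (by omega), h t (by omega)]

lemma measurable_noiseOf (t : ℕ) :
    Measurable fun e : Fin n → Unit × (Fin d → ℝ) => noiseOf e t := by
  unfold noiseOf
  split_ifs <;> fun_prop

lemma measurable_trajectory {Ω : Type*} [MeasurableSpace Ω] (A : Matrix (Fin d) (Fin d) ℝ)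
    {η : Ω → ℕ → Fin d → ℝ} (hη : ∀ t, Measurable fun ω => η ω t) (t : ℕ) :
    Measurable fun ω => trajectory A (η ω) t := by
  induction t with
  | zero => exact measurable_const
  | succ t ih =>
    have hA : Measurable fun x : Fin d → ℝ => A *ᵥ x :=
      (Continuous.matrix_mulVec continuous_const continuous_id).measurable
    exact (hA.comp ih).add (hη t)

/-- The shift of the noise which turns the system `A` into the system `A + D`. -/
noncomputable def systemShift (A D : Matrix (Fin d) (Fin d) ℝ) : PredictableShift Unit d :=
  fun t e _ => D *ᵥ trajectory (A + D) (noiseOf e) t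

lemma systemShift_isMeasurable (A D : Matrix (Fin d) (Fin d) ℝ) :
    (systemShift A D).IsMeasurable := by
  intro t
  have hD : Measurable fun x : Fin d → ℝ => D *ᵥ x :=
    (Continuous.matrix_mulVec continuous_const continuous_id).measurable
  exact hD.comp (measurable_trajectory (A + D)
    (η := fun p : (Fin t → Unit × (Fin d → ℝ)) × Unit => noiseOf p.1)
    (fun s => (measurable_noiseOf s).comp measurable_fst) t)

lemma systemShift_value (A D : Matrix (Fin d) (Fin d) ℝ) (e : Fin n → Unit × (Fin d → ℝ))
    (i : Fin n) : (systemShift A D).value e i = D *ᵥ trajectory (A + D) (noiseOf e) i := by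
  unfold PredictableShift.value systemShift
  congr 1
  refine trajectory_congr _ fun s hs => ?_
  have hsn : s < n := hs.trans i.2
  rw [noiseOf, dif_pos hs, noiseOf, dif_pos hsn]
  rfl

/-- The shift uses the perturbed state driven by the unshifted noise, since (A + D)x + η = Ax + (η +
Dx). The quadratic term is consequently an expectation under the alternative. -/
lemma trajectory_systemShift_map (A D : Matrix (Fin d) (Fin d) ℝ)
    (e : Fin n → Unit × (Fin d → ℝ)) {t : ℕ} (ht : t ≤ n) :
    trajectory A (noiseOf ((systemShift A D).map e)) t = trajectory (A + D) (noiseOf e) t := by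
  induction t with
  | zero => rfl
  | succ t ih =>
    have htn : t < n := ht
    rw [trajectory, trajectory, ih htn.le]
    have h1 : noiseOf ((systemShift A D).map e) t
        = noiseOf e t + D *ᵥ trajectory (A + D) (noiseOf e) t := by
      rw [noiseOf, dif_pos htn, noiseOf, dif_pos htn]
      change (e ⟨t, htn⟩).2 + (systemShift A D).value e ⟨t, htn⟩ = _
      rw [systemShift_value]
    rw [h1, Matrix.add_mulVec]
    abel

/-- The observations of the first `n + 1` steps of a trajectory. -/
noncomputable def systemData (A : Matrix (Fin d) (Fin d) ℝ) (n : ℕ) (η : ℕ → Fin d → ℝ) :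
    Data d d n :=
  fun i => (trajectory A η (i + 1), trajectory A η (i + 2))

lemma measurable_systemData {Ω : Type*} [MeasurableSpace Ω] (A : Matrix (Fin d) (Fin d) ℝ) (n : ℕ)
    {η : Ω → ℕ → Fin d → ℝ} (hη : ∀ t, Measurable fun ω => η ω t) :
    Measurable fun ω => systemData A n (η ω) :=
  measurable_pi_lambda _ fun _ =>
    (measurable_trajectory A hη _).prodMk (measurable_trajectory A hη _)

lemma infinitePi_map_fin {X : Type*} [MeasurableSpace X] (ν : Measure X) [IsProbabilityMeasure ν]
    (n : ℕ) : (Measure.infinitePi fun _ : ℕ => ν).map (fun η (i : Fin n) => η i)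
      = Measure.pi fun _ : Fin n => ν := by
  refine (Measure.pi_eq fun s hs => ?_).symm
  rw [Measure.map_apply (by fun_prop) (MeasurableSet.univ_pi hs)]
  have hpre : (fun (η : ℕ → X) (i : Fin n) => η i) ⁻¹' Set.univ.pi s
      = Set.pi (Finset.range n : Set ℕ) fun t => if h : t < n then s ⟨t, h⟩ else Set.univ := by
    ext η
    simp only [Set.mem_preimage, Set.mem_pi, Finset.coe_range, Set.mem_Iio]
    constructor
    · intro h t ht
      rw [dif_pos ht]
      exact h ⟨t, ht⟩ (Set.mem_univ _)
    · intro h i _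
      have := h i i.2
      rwa [dif_pos i.2] at this
  rw [hpre, Measure.infinitePi_pi, Finset.prod_range]
  · refine Finset.prod_congr rfl fun i _ => ?_
    rw [dif_pos i.2]
  · intro t _
    split_ifs
    · exact hs _
    · exact MeasurableSet.univ

/-- The last observed state is x_(n+1), so n observations involve n + 1 noise vectors; the exogenous
variable is trivial. -/
lemma systemModel_eq_map (A : Matrix (Fin d) (Fin d) ℝ) (n : ℕ) :
    systemModel σ A n
      = (Measure.pi fun _ : Fin (n + 1) => (Measure.dirac ()).prod (gaussianNoise σ d)).map
        fun e => systemData A n (noiseOf e) := by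
  have h1 : (Measure.infinitePi fun _ : ℕ => gaussianNoise σ d).map
      (fun η (i : Fin (n + 1)) => (((), η i) : Unit × (Fin d → ℝ)))
      = Measure.pi fun _ : Fin (n + 1) => (Measure.dirac ()).prod (gaussianNoise σ d) := by
    have h2 : ∀ _ : Fin (n + 1), (gaussianNoise σ d).map
        (fun y => (((), y) : Unit × (Fin d → ℝ)))
        = (Measure.dirac ()).prod (gaussianNoise σ d) := fun _ => (Measure.dirac_prod ()).symm
    have h3 : ∀ _ : Fin (n + 1), IsProbabilityMeasure ((gaussianNoise σ d).map
        (fun y => (((), y) : Unit × (Fin d → ℝ)))) := fun _ =>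
      Measure.isProbabilityMeasure_map (by fun_prop)
    simp only [← Measure.dirac_prod] at h3
    rw [← funext h2, ← Measure.pi_map_pi fun _ => by fun_prop, ← infinitePi_map_fin,
      Measure.map_map (by fun_prop) (by fun_prop)]
    rfl
  rw [← h1, Measure.map_map (measurable_systemData A n measurable_noiseOf) (by fun_prop)]
  unfold systemModel
  congr 1
  funext η i
  simp only [Function.comp_apply, systemData]
  congr 1 <;>
  · refine trajectory_congr A fun s hs => ?_
    have : s < n + 1 := by omega
    rw [noiseOf, dif_pos this]

lemma isProbabilityMeasure_systemModel (A : Matrix (Fin d) (Fin d) ℝ) (n : ℕ) :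
    IsProbabilityMeasure (systemModel σ A n) := by
  rw [systemModel_eq_map]
  exact Measure.isProbabilityMeasure_map
    (measurable_systemData A n measurable_noiseOf).aemeasurable

/-- Unrolling backwards, v·x_(t+1) = (Aᵀv)·x_t + v·η_t, so each step adds |v|² to the squared
coefficients and the supersolution V absorbs it. The vanishing of w from time t on keeps the slot
for η_t free. Stability of `A` is not needed, only the inequality for V. -/
lemma exists_linear_representation {A V : Matrix (Fin d) (Fin d) ℝ}
    (hV0 : ∀ v, 0 ≤ v ⬝ᵥ (V *ᵥ v))
    (hV : ∀ v, v ⬝ᵥ v + (Aᵀ *ᵥ v) ⬝ᵥ (V *ᵥ (Aᵀ *ᵥ v)) ≤ v ⬝ᵥ (V *ᵥ v)) {t : ℕ} (ht : t ≤ n)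
    (v : Fin d → ℝ) :
    ∃ w : Fin n → Fin d → ℝ, (∀ i : Fin n, t ≤ i → w i = 0) ∧
      (∀ e : Fin n → Unit × (Fin d → ℝ),
        v ⬝ᵥ trajectory A (noiseOf e) t = ∑ i, w i ⬝ᵥ (e i).2) ∧
      ∑ i, w i ⬝ᵥ w i ≤ v ⬝ᵥ (V *ᵥ v) := by
  induction t generalizing v with
  | zero => exact ⟨0, fun _ _ => rfl, fun e => by simp [trajectory], by simpa using hV0 v⟩
  | succ t ih =>
    have htn : t < n := ht
    obtain ⟨w, hw0, hw1, hw2⟩ := ih htn.le (Aᵀ *ᵥ v)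
    set k : Fin n := ⟨t, htn⟩
    have hwk : w k = 0 := hw0 k le_rfl
    refine ⟨Function.update w k v, ?_, ?_, ?_⟩
    · intro i hi
      have hik : i ≠ k := by
        intro h; rw [h] at hi; simp only [k] at hi; omega
      rw [Function.update_of_ne hik]
      exact hw0 i (by omega)
    · intro e
      have h1 : ∑ i, Function.update w k v i ⬝ᵥ (e i).2
          = v ⬝ᵥ (e k).2 + ∑ i, w i ⬝ᵥ (e i).2 := by
        rw [← Finset.add_sum_erase _ _ (Finset.mem_univ k),
          ← Finset.add_sum_erase _ (fun i => w i ⬝ᵥ (e i).2) (Finset.mem_univ k), hwk,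
          Function.update_self, zero_dotProduct, zero_add]
        congr 1
        refine Finset.sum_congr rfl fun i hi => ?_
        rw [Function.update_of_ne (Finset.ne_of_mem_erase hi)]
      rw [h1, ← hw1 e, trajectory, dotProduct_add, Matrix.dotProduct_mulVec,
        ← Matrix.mulVec_transpose, add_comm, noiseOf, dif_pos htn]
    · have h1 : ∑ i, Function.update w k v i ⬝ᵥ Function.update w k v i
          = v ⬝ᵥ v + ∑ i, w i ⬝ᵥ w i := by
        rw [← Finset.add_sum_erase _ _ (Finset.mem_univ k),
          ← Finset.add_sum_erase _ (fun i => w i ⬝ᵥ w i) (Finset.mem_univ k), hwk,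
          Function.update_self, zero_dotProduct, zero_add]
        congr 1
        refine Finset.sum_congr rfl fun i hi => ?_
        rw [Function.update_of_ne (Finset.ne_of_mem_erase hi)]
      rw [h1]
      linarith [hV v]

lemma lintegral_frame_trajectory_le {A V : Matrix (Fin d) (Fin d) ℝ}
    (hV0 : ∀ v, 0 ≤ v ⬝ᵥ (V *ᵥ v))
    (hV : ∀ v, v ⬝ᵥ v + (Aᵀ *ᵥ v) ⬝ᵥ (V *ᵥ (Aᵀ *ᵥ v)) ≤ v ⬝ᵥ (V *ᵥ v)) {t : ℕ} (ht : t ≤ n)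
    (F : Matrix (Fin d) (Fin r) ℝ) :
    ∫⁻ e, ENNReal.ofReal ((Fᵀ *ᵥ trajectory A (noiseOf e) t)
        ⬝ᵥ (Fᵀ *ᵥ trajectory A (noiseOf e) t))
        ∂Measure.pi (fun _ : Fin n => (Measure.dirac ()).prod (gaussianNoise σ d))
      ≤ ENNReal.ofReal (σ ^ 2 * (Fᵀ * V * F).trace) := by
  have hm := measurable_trajectory A (η := fun e : Fin n → Unit × (Fin d → ℝ) => noiseOf e)
    measurable_noiseOf t
  have hmj : ∀ j, Measurable fun e : Fin n → Unit × (Fin d → ℝ) =>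
      (F.col j ⬝ᵥ trajectory A (noiseOf e) t) ^ 2 := by
    intro j
    have : Continuous fun x : Fin d → ℝ => (F.col j ⬝ᵥ x) ^ 2 := by fun_prop
    exact this.measurable.comp hm
  simp only [transpose_mulVec_dotProduct_self]
  rw [lintegral_ofReal_sum _ hmj fun _ _ => sq_nonneg _, trace_transpose_mul_mul, Finset.mul_sum,
    ENNReal.ofReal_sum_of_nonneg fun j _ => mul_nonneg (sq_nonneg _) (hV0 _)]
  refine Finset.sum_le_sum fun j _ => ?_
  obtain ⟨w, -, hw1, hw2⟩ := exists_linear_representation hV0 hV ht (F.col j)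
  obtain ⟨hL, -, hsq⟩ := hasCenteredMoment_noise_sum (Measure.dirac ()) σ w
  simp only [hw1]
  rw [← ofReal_integral_eq_lintegral_ofReal hL.integrable_sq
    (Filter.Eventually.of_forall fun _ => sq_nonneg _), hsq]
  exact ENNReal.ofReal_le_ofReal (by gcongr)

theorem system_changeOfMeasureBound (hσ : 0 < σ) {A V : Matrix (Fin d) (Fin d) ℝ}
    {Q F : Matrix (Fin d) (Fin r) ℝ} (hQ : IsStiefel Q) {s : ℝ}
    (hV0 : ∀ v, 0 ≤ v ⬝ᵥ (V *ᵥ v))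
    (hV : ∀ v, v ⬝ᵥ v + ((A + s • (Q * Fᵀ))ᵀ *ᵥ v) ⬝ᵥ (V *ᵥ ((A + s • (Q * Fᵀ))ᵀ *ᵥ v))
      ≤ v ⬝ᵥ (V *ᵥ v)) (n : ℕ) {T : ℝ} (hT : σ ^ 2 * (Fᵀ * V * F).trace ≤ T) (hT0 : 0 ≤ T) :
    ChangeOfMeasureBound (systemModel σ (A + s • (Q * Fᵀ)) n) (systemModel σ A n)
      (n * (s ^ 2 * T / (2 * σ ^ 2))) := by
  set D := s • (Q * Fᵀ) with hD
  rw [systemModel_eq_map, systemModel_eq_map]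
  refine changeOfMeasureBound_map hσ _ (systemShift_isMeasurable A D)
    (measurable_systemData A n measurable_noiseOf) ?_ (by positivity) ?_
  · intro e
    funext i
    simp only [systemData]
    rw [trajectory_systemShift_map A D e (by omega), trajectory_systemShift_map A D e (by omega)]
  · have hquad : ∀ e : Fin (n + 1) → Unit × (Fin d → ℝ),
        (systemShift A D).quad e / (2 * σ ^ 2)
        = ∑ i : Fin n, s ^ 2 / (2 * σ ^ 2)
          * ((Fᵀ *ᵥ trajectory (A + D) (noiseOf e) (i + 1))
            ⬝ᵥ (Fᵀ *ᵥ trajectory (A + D) (noiseOf e) (i + 1))) := by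
      intro e
      simp only [PredictableShift.quad, systemShift_value]
      -- Since x_0 = 0 the first noise vector is not shifted, so n + 1 noise vectors cost only n
      -- terms.
      have h0 : D *ᵥ trajectory (A + D) (noiseOf e) ((0 : Fin (n + 1)) : ℕ) = 0 :=
        Matrix.mulVec_zero D
      rw [Fin.sum_univ_succ, h0, zero_dotProduct, zero_add, Finset.sum_div]
      refine Finset.sum_congr rfl fun i _ => ?_
      rw [hD, lowRank_mulVec_dotProduct_self hQ, Fin.val_succ]
      ring
    have hm : ∀ t, Measurable fun e : Fin (n + 1) → Unit × (Fin d → ℝ) =>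
        (Fᵀ *ᵥ trajectory (A + D) (noiseOf e) t) ⬝ᵥ (Fᵀ *ᵥ trajectory (A + D) (noiseOf e) t) := by
      intro t
      have h1 : Continuous fun x : Fin d → ℝ => Fᵀ *ᵥ x :=
        Continuous.matrix_mulVec continuous_const continuous_id
      exact (h1.dotProduct h1).measurable.comp (measurable_trajectory (A + D) measurable_noiseOf t)
    have hc : 0 ≤ s ^ 2 / (2 * σ ^ 2) := by positivity
    simp only [hquad]
    rw [lintegral_ofReal_sum _ fun i => (hm _).const_mul _]
    · refine (Finset.sum_le_sum (g := fun _ => ENNReal.ofReal (s ^ 2 * T / (2 * σ ^ 2)))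
        fun i _ => ?_).trans ?_
      · simp only [ENNReal.ofReal_mul hc]
        rw [lintegral_const_mul _ (hm _).ennreal_ofReal, mul_div_right_comm,
          ENNReal.ofReal_mul hc]
        gcongr
        exact (lintegral_frame_trajectory_le hV0 hV (by omega) F).trans
          (ENNReal.ofReal_le_ofReal hT)
      · rw [Finset.sum_const, Finset.card_univ, Fintype.card_fin,
          ENNReal.ofReal_mul (by positivity), nsmul_eq_mul, ENNReal.ofReal_natCast]
    · intro i e
      exact mul_nonneg hc (Finset.sum_nonneg fun _ _ => mul_self_nonneg _)

end System

/-! ### Assembling the sample complexity bounds. -/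

section Conclusion

/-- The testing bound along an isometric image of a packing. -/
lemma packing_entropy_lower_bound {dx dy d r n : ℕ} {P : Model dx dy}
    {𝒞 : Set (Matrix (Fin dy) (Fin dx) ℝ)} {ε δ K : ℝ} {alg : Algorithm dx dy}
    {A : Matrix (Fin dy) (Fin dx) ℝ} (hP : IsProbabilityMeasure (P A n)) (hr : 1 ≤ r) (hd : 2 ≤ d)
    (hε : 0 < ε) (hδ2 : δ ≤ 1 / 2) (halg : alg.IsMeasurable)
    (hstable : StableWith P 𝒞 ε δ alg n) (hA : A ∈ 𝒞)
    {S : Finset (Matrix (Fin d) (Fin r) ℝ)} (hS : IsStiefelPacking packingConst S)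
    (Φ : Matrix (Fin d) (Fin r) ℝ → Matrix (Fin dy) (Fin dx) ℝ) (hΦ : ∀ Q ∈ S, Φ Q ∈ 𝒞)
    (hΦS : ∀ Q Q', frobSq (Φ Q - Φ Q')
      = (2 * packingConst * ε / Real.sqrt r) ^ 2 * frobSq (Q - Q'))
    (hΦA : ∀ Q, frobSq (A - Φ Q) = (2 * packingConst * ε / Real.sqrt r) ^ 2 * frobSq Q)
    (hK : ∀ Q ∈ S, ChangeOfMeasureBound (P (Φ Q) n) (P A n) K) :
    Real.log (1 / δ) + r * d ≤ 150000 * K := by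
  classical
  have hr0 : (0 : ℝ) < r := by exact_mod_cast hr
  have hC : (1 : ℝ) < packingConst := by unfold packingConst; norm_num
  have hC0 : 0 < packingConst := by linarith
  have hs : (2 * packingConst * ε / Real.sqrt r) ^ 2 = 4 * packingConst ^ 2 * ε ^ 2 / r := by
    rw [div_pow, Real.sq_sqrt hr0.le]; ring
  have hsepS : ∀ Q ∈ S, ∀ Q' ∈ S, Q ≠ Q' → 4 * ε ^ 2 < frobSq (Φ Q - Φ Q') := by
    intro Q hQ Q' hQ' hne
    have h1 := hS.2.2 Q hQ Q' hQ' hne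
    have h2 : Real.sqrt r / packingConst = Real.sqrt (r / packingConst ^ 2) := by
      rw [Real.sqrt_div hr0.le, Real.sqrt_sq hC0.le]
    rw [frobNorm_eq_sqrt_frobSq, h2] at h1
    have h3 := (Real.sqrt_lt_sqrt_iff (by positivity)).1 h1
    rw [hΦS, hs]
    calc 4 * ε ^ 2 = 4 * packingConst ^ 2 * ε ^ 2 / r * (r / packingConst ^ 2) := by field_simp
      _ < _ := by gcongr
  have hinj : Set.InjOn Φ S := by
    intro Q hQ Q' hQ' h
    by_contra hne
    have := hsepS Q hQ Q' hQ' hne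
    rw [h, sub_self] at this
    simp only [frobSq, Matrix.zero_apply] at this
    norm_num at this
    nlinarith [sq_nonneg ε]
  have := entropy_lower_bound (P := P) (𝒞 := 𝒞) (K := K) (N := r * d) hε hδ2 (by nlinarith) halg
    hstable hA (S.image Φ) ?_ ?_ ?_ ?_ ?_
  · push_cast at this
    exact this
  · intro B hB
    obtain ⟨Q, hQ, rfl⟩ := Finset.mem_image.1 hB
    exact hΦ Q hQ
  · rw [Finset.card_image_of_injOn hinj]
    exact hS.2.1
  · intro B hB B' hB' hne
    obtain ⟨Q, hQ, rfl⟩ := Finset.mem_image.1 hB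
    obtain ⟨Q', hQ', rfl⟩ := Finset.mem_image.1 hB'
    exact hsepS Q hQ Q' hQ' fun h => hne (by rw [h])
  · intro B hB
    obtain ⟨Q, hQ, rfl⟩ := Finset.mem_image.1 hB
    rw [hΦA, hs, frobSq_of_isStiefel (hS.1 Q hQ), div_mul_cancel₀ _ hr0.ne']
    have : (1 : ℝ) < packingConst ^ 2 := one_lt_pow₀ hC (by norm_num)
    have hε2 : 0 < ε ^ 2 := by positivity
    nlinarith
  · intro B hB
    obtain ⟨Q, hQ, rfl⟩ := Finset.mem_image.1 hB
    exact hK Q hQ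

lemma entropy_bound_to_sample_bound {r n : ℕ} {σ ε lam X : ℝ} (hr : 1 ≤ r) (hσ : 0 < σ)
    (hε : 0 < ε) (hX : 0 < X)
    (h : X ≤ 150000 * (n * ((2 * packingConst * ε / Real.sqrt r) ^ 2 * (4 * (r * lam))
      / (2 * σ ^ 2)))) :
    1 / (1200000 * packingConst ^ 2) * (σ ^ 2 * X / (ε ^ 2 * lam)) ≤ n := by
  have hr0 : (0 : ℝ) < r := by exact_mod_cast hr
  have hC0 : 0 < packingConst := by unfold packingConst; norm_num
  have h1 : 150000 * (n * ((2 * packingConst * ε / Real.sqrt r) ^ 2 * (4 * (r * lam))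
      / (2 * σ ^ 2))) = 1200000 * packingConst ^ 2 * (n * ε ^ 2) / σ ^ 2 * lam := by
    rw [div_pow, Real.sq_sqrt hr0.le]
    field_simp
    ring
  rw [h1] at h
  -- Positivity of the eigenvalue average is forced by the entropy bound itself.
  have hlam : 0 < lam := by
    by_contra! hneg
    have : 1200000 * packingConst ^ 2 * (n * ε ^ 2) / σ ^ 2 * lam ≤ 0 :=
      mul_nonpos_of_nonneg_of_nonpos (by positivity) hneg
    linarith
  rw [div_mul_div_comm, one_mul, div_le_iff₀ (by positivity)]
  calc σ ^ 2 * X ≤ σ ^ 2 * (1200000 * packingConst ^ 2 * (n * ε ^ 2) / σ ^ 2 * lam) := by gcongr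
    _ = _ := by field_simp

section Alternatives

variable {dx dy r : ℕ} (A : Matrix (Fin dy) (Fin dx) ℝ) (s : ℝ)

lemma frobSq_left_alternatives {W : Matrix (Fin dx) (Fin r) ℝ} (hW : IsStiefel W)
    (Q Q' : Matrix (Fin dy) (Fin r) ℝ) :
    frobSq ((A + s • (Q * Wᵀ)) - (A + s • (Q' * Wᵀ))) = s ^ 2 * frobSq (Q - Q') := by
  rw [add_sub_add_left_eq_sub, ← smul_sub, ← Matrix.sub_mul, frobSq_smul,
    frobSq_mul_transpose_of_isStiefel _ hW]

lemma frobSq_left_alternative {W : Matrix (Fin dx) (Fin r) ℝ} (hW : IsStiefel W)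
    (Q : Matrix (Fin dy) (Fin r) ℝ) : frobSq (A - (A + s • (Q * Wᵀ))) = s ^ 2 * frobSq Q := by
  rw [sub_add_cancel_left, frobSq_neg, frobSq_smul, frobSq_mul_transpose_of_isStiefel _ hW]

lemma frobSq_right_alternatives {U : Matrix (Fin dy) (Fin r) ℝ} (hU : IsStiefel U)
    (R R' : Matrix (Fin dx) (Fin r) ℝ) :
    frobSq ((A + s • (U * Rᵀ)) - (A + s • (U * R'ᵀ))) = s ^ 2 * frobSq (R - R') := by
  rw [add_sub_add_left_eq_sub, ← smul_sub, ← Matrix.mul_sub, ← Matrix.transpose_sub, frobSq_smul,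
    frobSq_stiefel_mul hU, frobSq_transpose]

lemma frobSq_right_alternative {U : Matrix (Fin dy) (Fin r) ℝ} (hU : IsStiefel U)
    (R : Matrix (Fin dx) (Fin r) ℝ) : frobSq (A - (A + s • (U * Rᵀ))) = s ^ 2 * frobSq R := by
  rw [sub_add_cancel_left, frobSq_neg, frobSq_smul, frobSq_stiefel_mul hU, frobSq_transpose]

end Alternatives

/-- Both sample complexity bounds, for any model in which low-rank perturbations change the law
in a way controlled by the covariance `M`. -/
theorem sample_lower_bounds {dx dy r n : ℕ} {σ ε δ : ℝ} {P : Model dx dy}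
    {M : Matrix (Fin dx) (Fin dx) ℝ} {A : Matrix (Fin dy) (Fin dx) ℝ}
    {U : Matrix (Fin dy) (Fin r) ℝ} {W : Matrix (Fin dx) (Fin r) ℝ}
    {Py : Finset (Matrix (Fin dy) (Fin r) ℝ)} {Px : Finset (Matrix (Fin dx) (Fin r) ℝ)}
    {alg : Algorithm dx dy} (hr : 1 ≤ r) (hrd : 2 * r ≤ min dx dy) (hσ : 0 < σ) (hε : 0 < ε)
    (hδ : 0 < δ) (hδ2 : δ ≤ 1 / 2) (hP : IsProbabilityMeasure (P A n)) (hM : M.PosSemidef)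
    (hU : IsStiefel U) (hW : IsBottomEigenframe M W) (hPy : IsStiefelPacking packingConst Py)
    (hPx : IsStiefelPacking packingConst Px) (halg : alg.IsMeasurable)
    (hstable : StableWith P (confusingModels packingConst ε A U W Py Px) ε δ alg n)
    (hchange : ∀ (Q : Matrix (Fin dy) (Fin r) ℝ) (V : Matrix (Fin dx) (Fin r) ℝ),
      IsStiefel Q → IsStiefel V → ∀ T, 4 * (Vᵀ * M * V).trace ≤ T → 0 ≤ T →
      ChangeOfMeasureBound (P (A + (2 * packingConst * ε / Real.sqrt r) • (Q * Vᵀ)) n) (P A n)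
        (n * ((2 * packingConst * ε / Real.sqrt r) ^ 2 * T / (2 * σ ^ 2)))) :
    1 / (1200000 * packingConst ^ 2) * (σ ^ 2 * (Real.log (1 / δ) + r * dy)
        / (ε ^ 2 * lambdaLow r M)) ≤ n ∧
      1 / (1200000 * packingConst ^ 2) * (σ ^ 2 * (Real.log (1 / δ) + r * dx)
        / (ε ^ 2 * lambdaHigh r M)) ≤ n := by
  have hr0 : (0 : ℝ) < r := by exact_mod_cast hr
  have hlog : 0 ≤ Real.log (1 / δ) := Real.log_nonneg (by rw [le_div_iff₀ hδ]; linarith)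
  have hrx : 2 * r ≤ dx := hrd.trans (min_le_left _ _)
  have hry : 2 * r ≤ dy := hrd.trans (min_le_right _ _)
  have hdx : (0 : ℝ) < dx := by exact_mod_cast (by omega : 0 < dx)
  have hdy : (0 : ℝ) < dy := by exact_mod_cast (by omega : 0 < dy)
  have htrace : ∀ V : Matrix (Fin dx) (Fin r) ℝ, 0 ≤ (Vᵀ * M * V).trace := by
    intro V
    rw [trace_transpose_mul_mul]
    exact Finset.sum_nonneg fun j _ => hM.dotProduct_mulVec_nonneg (V.col j)
  constructor
  · refine entropy_bound_to_sample_bound hr hσ hε (by positivity)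
      (packing_entropy_lower_bound hP hr (by omega) hε hδ2 halg hstable ?_ hPy
        (fun Q => A + (2 * packingConst * ε / Real.sqrt r) • (Q * Wᵀ)) ?_
        (frobSq_left_alternatives A _ hW.1) (frobSq_left_alternative A _ hW.1) ?_)
    · exact Or.inl (Or.inl rfl)
    · exact fun Q hQ => Or.inl (Or.inr ⟨Q, hQ, rfl⟩)
    · intro Q hQ
      -- Every left alternative has the same right frame `W`, so the trace is known exactly.
      have h := trace_bottomEigenframe hr hW
      refine hchange Q W (hPy.1 Q hQ) hW.1 _ (by rw [h]) ?_
      rw [← h]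
      exact mul_nonneg (by norm_num) (htrace W)
  · refine entropy_bound_to_sample_bound hr hσ hε (by positivity)
      (packing_entropy_lower_bound hP hr (by omega) hε hδ2 halg hstable ?_ hPx
        (fun R => A + (2 * packingConst * ε / Real.sqrt r) • (U * Rᵀ)) ?_
        (frobSq_right_alternatives A _ hU) (frobSq_right_alternative A _ hU) ?_)
    · exact Or.inl (Or.inl rfl)
    · exact fun R hR => Or.inr ⟨R, hR, rfl⟩
    · intro R hR
      -- Here the right frame ranges over the whole packing, so only Ky Fan's upper bound is
      -- available.
      have h := trace_compression_le hM.isHermitian hr (by omega) (hPx.1 R hR)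
      exact hchange U R hU (hPx.1 R hR) _ (by gcongr)
        (mul_nonneg (by norm_num) ((htrace R).trans h))

lemma limitCov_posSemidef {d : ℕ} {σ : ℝ} {A : Matrix (Fin d) (Fin d) ℝ} (hA : IsSchurStable A) :
    (limitCov σ A).PosSemidef := by
  have hG : (gramian A).PosSemidef :=
    Matrix.PosSemidef.of_dotProduct_mulVec_nonneg gramian_isHermitian fun v => by
      rw [star_trivial]; exact gramian_quadForm_nonneg hA v
  exact hG.smul (sq_nonneg σ)

end Conclusion

end RankLB

theorem mainTheorem1 :
    ∃ C : ℝ, 1 ≤ C ∧ ∃ c : ℝ, 0 < c ∧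
      -- packings with constant `C` exist, so the stability notions below are meaningful
      (∀ d k : ℕ, 1 ≤ k → 2 * k ≤ d →
        ∃ P : Finset (Matrix (Fin d) (Fin k) ℝ), RankLB.IsStiefelPacking C P) ∧
      -- multivariate regression
      (∀ (dx dy r : ℕ) (σ ε δ : ℝ) (μ : Measure (Fin dx → ℝ)) (A : Matrix (Fin dy) (Fin dx) ℝ)
        (U : Matrix (Fin dy) (Fin r) ℝ) (W : Matrix (Fin dx) (Fin r) ℝ)
        (Py : Finset (Matrix (Fin dy) (Fin r) ℝ)) (Px : Finset (Matrix (Fin dx) (Fin r) ℝ))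
        (alg : RankLB.Algorithm dx dy),
        1 ≤ r → 2 * r ≤ min dx dy → A.rank ≤ r →
        0 < σ → 0 < ε → 0 < δ → δ ≤ 1 / 2 →
        IsProbabilityMeasure μ → (∀ i, MemLp (fun x : Fin dx → ℝ => x i) 2 μ) →
        (RankLB.secondMoment μ).PosDef →
        RankLB.IsTopLeftSingularFrame A U →
        RankLB.IsBottomEigenframe (RankLB.secondMoment μ) W →
        RankLB.IsStiefelPacking C Py → RankLB.IsStiefelPacking C Px →
        alg.IsMeasurable →
        RankLB.IsStable (RankLB.regressionModel μ σ)
          (RankLB.confusingModels C ε A U W Py Px) ε δ alg →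
        c * (σ ^ 2 * (Real.log (1 / δ) + r * dy)
            / (ε ^ 2 * RankLB.lambdaLow r (RankLB.secondMoment μ)))
          ≤ RankLB.sampleComplexity (RankLB.regressionModel μ σ)
              (RankLB.confusingModels C ε A U W Py Px) ε δ alg ∧
        c * (σ ^ 2 * (Real.log (1 / δ) + r * dx)
            / (ε ^ 2 * RankLB.lambdaHigh r (RankLB.secondMoment μ)))
          ≤ RankLB.sampleComplexity (RankLB.regressionModel μ σ)
              (RankLB.confusingModels C ε A U W Py Px) ε δ alg) ∧
      -- linear system identification
      (∀ (d r : ℕ) (σ ε δ : ℝ) (A : Matrix (Fin d) (Fin d) ℝ)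
        (U W : Matrix (Fin d) (Fin r) ℝ) (Py Px : Finset (Matrix (Fin d) (Fin r) ℝ))
        (alg : RankLB.Algorithm d d),
        1 ≤ r → 2 * r ≤ d → A.rank ≤ r →
        0 < σ → 0 < ε → 0 < δ → δ ≤ 1 / 2 →
        RankLB.IsSchurStable A →
        2 * C * ε / Real.sqrt r ≤ 1 / (4 * RankLB.opNorm (RankLB.gramian A) ^ 3) →
        RankLB.IsTopLeftSingularFrame A U →
        RankLB.IsBottomEigenframe (RankLB.limitCov σ A) W →
        RankLB.IsStiefelPacking C Py → RankLB.IsStiefelPacking C Px →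
        alg.IsMeasurable →
        RankLB.IsStable (RankLB.systemModel σ)
          (RankLB.confusingModels C ε A U W Py Px) ε δ alg →
        c * (σ ^ 2 * (Real.log (1 / δ) + r * d)
            / (ε ^ 2 * RankLB.lambdaLow r (RankLB.limitCov σ A)))
          ≤ RankLB.sampleComplexity (RankLB.systemModel σ)
              (RankLB.confusingModels C ε A U W Py Px) ε δ alg ∧
        c * (σ ^ 2 * (Real.log (1 / δ) + r * d)
            / (ε ^ 2 * RankLB.lambdaHigh r (RankLB.limitCov σ A)))
          ≤ RankLB.sampleComplexity (RankLB.systemModel σ)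
              (RankLB.confusingModels C ε A U W Py Px) ε δ alg) := by
  refine ⟨RankLB.packingConst, by unfold RankLB.packingConst; norm_num,
    1 / (1200000 * RankLB.packingConst ^ 2), by unfold RankLB.packingConst; positivity,
    fun d k hk hkd => RankLB.exists_stiefelPacking hk hkd, ?_, ?_⟩
  · intro dx dy r σ ε δ μ A U W Py Px alg hr hrd _ hσ hε hδ hδ2 hμ hmem hpd hU hW hPy hPx halg hst
    -- By stability the infimum is attained, so the bounds for a fixed n apply to it.
    have hn := Nat.sInf_mem hst
    refine RankLB.sample_lower_bounds hr hrd hσ hε hδ hδ2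
      (RankLB.isProbabilityMeasure_regressionModel A _) hpd.posSemidef hU.1 hW hPy hPx halg hn ?_
    intro Q V hQ hV T hT hT0
    exact RankLB.regression_changeOfMeasureBound hσ hmem A hQ V _ _ (by linarith) hT0
  · intro d r σ ε δ A U W Py Px alg hr hrd _ hσ hε hδ hδ2 hA hsmall hU hW hPy hPx halg hst
    have hn := Nat.sInf_mem hst
    have hC : 0 ≤ RankLB.packingConst := by unfold RankLB.packingConst; norm_num
    refine RankLB.sample_lower_bounds hr (by rwa [min_self]) hσ hε hδ hδ2
      (RankLB.isProbabilityMeasure_systemModel A _) (RankLB.limitCov_posSemidef hA) hU.1 hW hPy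
      hPx halg hn ?_
    intro Q V hQ hV T hT hT0
    -- The factor 4 matches the one in `sample_lower_bounds`, which regression satisfies with room
    -- to spare.
    refine RankLB.system_changeOfMeasureBound (V := (4 : ℝ) • RankLB.gramian A) hσ hQ ?_
      (RankLB.gramian_lyapunov_perturbed (by omega) hA (by positivity) hsmall
        (RankLB.lowRank_transpose_mulVec_le hQ hV _)) _ ?_ hT0
    · intro v
      rw [Matrix.smul_mulVec, dotProduct_smul, smul_eq_mul]
      exact mul_nonneg (by norm_num) (RankLB.gramian_quadForm_nonneg hA v)
    · refine le_trans (le_of_eq ?_) hT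
      simp only [RankLB.limitCov, Matrix.mul_smul, Matrix.smul_mul, Matrix.trace_smul, smul_eq_mul]
      ring
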